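/- **Setting.** There are $n$ arms with unknown utilities $u\in\mathbb R^n$, and $w(v,M)=\sum_{a\in M}v(a)$ for $v\in\mathbb R^n$, $M\subseteq[n]$; write $w(M)=w(u,M)$. There are $m\ge 1$ stages and integers $n=K_0>K_1>\dots>K_m\ge 1$. A pull of arm $a$ in stage $i$ costs $j_i\ge 1$, has information gain $s_i>0$, and yields an independent reward with mean $u(a)$ which, after centering, is $\sigma/\sqrt{s_i}$-sub-Gaussian ($\sigma>0$). $\mathrm{Oracle}_K(v,A)$ is a maximizer of $w(v,\cdot)$ over the $K$-element subsets of $A$ (ties are broken arbitrarily). At any time let $\mathrm{Cost}$ be the total cost of all pulls so far, $T(a)$ the total information gain of arm $a$ so far (over all stages), and $\hat u(a)$ the mean of the rewards of $a$ so far, weighted by their information gains. **CACO.** Let $\delta,\epsilon\in(0,1)$ and $A_0=[n]$. In stage $i=1,\dots,m$, pull every arm of $A_{i-1}$ once, and then repeat the following. Let $A_i=\mathrm{Oracle}_{K_i}(\hat u,A_{i-1})$ and $\mathrm{rad}(a)=\sigma\sqrt{2\log(4K_{i-1}\mathrm{Cost}^3/\delta)/T(a)}$. Let $\tilde u(a)=\hat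 u(a)-\mathrm{rad}(a)$ for $a\in A_i$ and $\tilde u(a)=\hat u(a)+\mathrm{rad}(a)$ for $a\in A_{i-1}\setminus A_i$, and let $\tilde A_i=\mathrm{Oracle}_{K_i}(\tilde u,A_{i-1})$. If $|w(\tilde u,\tilde A_i)-w(\tilde u,A_i)|<\epsilon$, end the stage; otherwise pull the arm of $(\tilde A_i\setminus A_i)\cup(A_i\setminus\tilde A_i)$ with the largest $\mathrm{rad}$. After stage $m$ return $\mathrm{Out}=A_m$. **Notation for the bound.** For each stage $i$ let $M_i^*$ be an optimal set of that stage, that is, a maximizer of $w$ over the $K_i$-element subsets of $A_{i-1}$. For $a\in A_{i-1}$ let $\Delta_a$ (which depends on $i$) be $w(M_i^*)$ minus the largest $w(M)$ over the $K_i$-element $M\subseteq A_{i-1}$ with $a\in M$ if $a\notin M_i^*$, and with $a\notin M$ if $a\in M_i^*$. Let $H_i=\sum_{a\in A_{i-1}}\min\{\Delta_a^{-2},K_i^2/\epsilon^2\}$, where $0^{-2}=\infty$. **Theorem.** There is a universal constant $C>0$ such that, for all choices of the above, with probability at least $1-\delta$ CACO halts, its output satisfies $|w(\mathrm{Out})-w(M_m^*)|<\epsilon$,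 and its total cost $T$ satisfies $$T\le C\left(\sum_{i=1}^m j_iK_{i-1}+\sigma^2\sum_{i=1}^m\frac{j_i}{s_i}\,H_i\,\log\!\left(\frac{\sigma^2j_i^4}{s_i\delta}H_i\right)\right).$$ Here $\sum_i j_iK_{i-1}$ is the cost of the mandatory initial pulls. -/

import Mathlib

noncomputable section

/-- The linear objective: the utility `w(v, M)` of a cohort `M` when arm `a` has utility `v a`. -/
def cohortValue {n : ℕ} (v : Fin n → ℝ) (M : Finset (Fin n)) : ℝ := ∑ a ∈ M, v a

/-- A maximization oracle: `oracle K v A` maximizes `w(v, ·)` over the `K`-element subsets of `A`.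
Ties are broken in an arbitrary (but measurable) way. -/
structure IsMaxOracle {n : ℕ}
    (oracle : ℕ → (Fin n → ℝ) → Finset (Fin n) → Finset (Fin n)) : Prop where
  mem : ∀ (K : ℕ) (v : Fin n → ℝ) (A : Finset (Fin n)), K ≤ A.card →
    oracle K v A ∈ A.powersetCard K
  le : ∀ (K : ℕ) (v : Fin n → ℝ) (A : Finset (Fin n)), K ≤ A.card →
    ∀ M ∈ A.powersetCard K, cohortValue v M ≤ cohortValue v (oracle K v A)
  measurable : ∀ (K : ℕ) (A M : Finset (Fin n)), MeasurableSet {v | oracle K v A = M}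

/-- `pick v D` is an arm of `D` at which `v` is largest (ties broken arbitrarily, measurably). -/
structure IsArgmaxRule {n : ℕ} (pick : (Fin n → ℝ) → Finset (Fin n) → Fin n) : Prop where
  mem : ∀ (v : Fin n → ℝ) (D : Finset (Fin n)), D.Nonempty → pick v D ∈ D
  le : ∀ (v : Fin n → ℝ) (D : Finset (Fin n)), ∀ b ∈ D, v b ≤ v (pick v D)
  measurable : ∀ (D : Finset (Fin n)) (a : Fin n), MeasurableSet {v | pick v D = a}

/-- The input of the algorithm. Stages are numbered `0, …, m - 1`. Stage `i` starts with `K i`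
active arms and keeps `K (i + 1)` of them; one pull in stage `i` has information gain `s i` and
cost `j i`. -/
structure CacoInput (n : ℕ) where
  m : ℕ
  K : ℕ → ℕ
  s : ℕ → ℝ
  j : ℕ → ℝ
  σ : ℝ
  ε : ℝ
  δ : ℝ
  oracle : ℕ → (Fin n → ℝ) → Finset (Fin n) → Finset (Fin n)
  pick : (Fin n → ℝ) → Finset (Fin n) → Fin n

/-- The admissible inputs: at least one stage, `n = K 0 > K 1 > ⋯ > K m ≥ 1`, positive information
gains, costs at least `1`, `σ > 0`, and `ε, δ ∈ (0, 1)`. -/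
structure CacoInput.Valid {n : ℕ} (I : CacoInput n) : Prop where
  m_pos : 1 ≤ I.m
  K_zero : I.K 0 = n
  K_lt : ∀ i < I.m, I.K (i + 1) < I.K i
  K_last : 1 ≤ I.K I.m
  s_pos : ∀ i < I.m, 0 < I.s i
  j_ge : ∀ i < I.m, 1 ≤ I.j i
  σ_pos : 0 < I.σ
  ε_mem : I.ε ∈ Set.Ioo (0 : ℝ) 1
  δ_mem : I.δ ∈ Set.Ioo (0 : ℝ) 1
  oracle_max : IsMaxOracle I.oracle
  pick_max : IsArgmaxRule I.pick

/-- The memory of the algorithm. -/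
structure CacoState (n : ℕ) where
  /-- the current stage; the algorithm has halted once it equals `m` -/
  stage : ℕ
  /-- whether the initial pulls of the current stage are still to be made -/
  fresh : Bool
  /-- `active i` is the set of arms that are active in stage `i`; `active m` is the output -/
  active : ℕ → Finset (Fin n)
  /-- the total information gain of each arm, over all stages so far -/
  info : Fin n → ℝ
  /-- the sum of the rewards of each arm, each weighted by its information gain -/
  wsum : Fin n → ℝ
  /-- the total cost so far, over all stages -/
  cost : ℝ

namespace CacoState

/-- The empirical mean: a pull with information gain `s` counts like `s` pulls of gain one. -/
def mean {n : ℕ} (st : CacoState n) (a : Fin n) : ℝ := st.wsum a / st.info a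

/-- Pull every arm of `B` once, with information gain `s` per pull and rewards `x`. -/
def pull {n : ℕ} (st : CacoState n) (B : Finset (Fin n)) (s : ℝ) (x : Fin n → ℝ) (c : ℝ) :
    CacoState n :=
  { st with
    info := fun a => if a ∈ B then st.info a + s else st.info a
    wsum := fun a => if a ∈ B then st.wsum a + s * x a else st.wsum a
    cost := st.cost + c }

end CacoState

namespace CacoInput

/-- The confidence radius of an arm. -/
def rad {n : ℕ} (I : CacoInput n) (st : CacoState n) (a : Fin n) : ℝ :=
  I.σ * √(2 * Real.log (4 * (I.K st.stage : ℝ) * st.cost ^ 3 / I.δ) / st.info a)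

/-- The empirically best cohort among the active arms. -/
def empBest {n : ℕ} (I : CacoInput n) (st : CacoState n) : Finset (Fin n) :=
  I.oracle (I.K (st.stage + 1)) st.mean (st.active st.stage)

/-- The pessimistic estimates: lowered on the empirically best cohort, raised off it. -/
def pess {n : ℕ} (I : CacoInput n) (st : CacoState n) (a : Fin n) : ℝ :=
  if a ∈ I.empBest st then st.mean a - I.rad st a else st.mean a + I.rad st a

/-- The best cohort among the active arms under the pessimistic estimates. -/
def pessBest {n : ℕ} (I : CacoInput n) (st : CacoState n) : Finset (Fin n) :=
  I.oracle (I.K (st.stage + 1)) (I.pess st) (st.active st.stage)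

/-- The condition that ends a stage. -/
def closeEnough {n : ℕ} (I : CacoInput n) (st : CacoState n) : Prop :=
  |cohortValue (I.pess st) (I.pessBest st) - cohortValue (I.pess st) (I.empBest st)| < I.ε

/-- The arm with the largest confidence radius in the symmetric difference of the two cohorts. -/
def nextArm {n : ℕ} (I : CacoInput n) (st : CacoState n) : Fin n :=
  I.pick (I.rad st)
    ((I.pessBest st \ I.empBest st) ∪ (I.empBest st \ I.pessBest st))

/-- Initially all arms are active and nothing has been pulled. -/
def start (n : ℕ) : CacoState n where
  stage := 0
  fresh := true
  active := fun _ => Finset.univ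
  info := fun _ => 0
  wsum := fun _ => 0
  cost := 0

open Classical in
/-- One step of the algorithm; `x i a` is the reward that a pull of arm `a` in stage `i` yields
during this step. A step is the batch of initial pulls of a stage, or the end of a stage, or one
further pull. A halted algorithm stays as it is. -/
def step {n : ℕ} (I : CacoInput n) (x : ℕ → Fin n → ℝ) (st : CacoState n) : CacoState n :=
  if I.m ≤ st.stage then st
  else if st.fresh = true then
    { st.pull (st.active st.stage) (I.s st.stage) (x st.stage)
        ((I.K st.stage : ℝ) * I.j st.stage) with fresh := false }
  else if I.closeEnough st then
    { st with
      stage := st.stage + 1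
      fresh := true
      active := Function.update st.active (st.stage + 1) (I.empBest st) }
  else
    st.pull {I.nextArm st} (I.s st.stage) (x st.stage) (I.j st.stage)

/-- The state after `t` steps on the reward table `x`. -/
def run {n : ℕ} (I : CacoInput n) (x : ℕ → ℕ → Fin n → ℝ) : ℕ → CacoState n
  | 0 => start n
  | t + 1 => I.step (x t) (I.run x t)

/-- The optimal cohort of stage `i`, for the true utilities `u` and active arms `A`. -/
def optimal {n : ℕ} (I : CacoInput n) (u : Fin n → ℝ) (i : ℕ) (A : Finset (Fin n)) :
    Finset (Fin n) :=
  I.oracle (I.K (i + 1)) u A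

/-- The gap score of arm `a` in stage `i`, when the arms of `A` are active. -/
def gap {n : ℕ} (I : CacoInput n) (u : Fin n → ℝ) (i : ℕ) (A : Finset (Fin n)) (a : Fin n) : ℝ :=
  if a ∈ I.optimal u i A then
    cohortValue u (I.optimal u i A) -
      sSup (cohortValue u '' {M | M ∈ A.powersetCard (I.K (i + 1)) ∧ a ∉ M})
  else
    cohortValue u (I.optimal u i A) -
      sSup (cohortValue u '' {M | M ∈ A.powersetCard (I.K (i + 1)) ∧ a ∈ M})

/-- `min {1 / Δ_a ^ 2, K_i ^ 2 / ε ^ 2}`, where `1 / 0` counts as infinity. -/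
def armHardness {n : ℕ} (I : CacoInput n) (u : Fin n → ℝ) (i : ℕ) (A : Finset (Fin n))
    (a : Fin n) : ℝ :=
  if I.gap u i A a = 0 then (I.K (i + 1) : ℝ) ^ 2 / I.ε ^ 2
  else min (1 / I.gap u i A a ^ 2) ((I.K (i + 1) : ℝ) ^ 2 / I.ε ^ 2)

/-- The sum of `armHardness` over the arms that are active in stage `i`. -/
def stageHardness {n : ℕ} (I : CacoInput n) (u : Fin n → ℝ) (i : ℕ) (A : Finset (Fin n)) : ℝ :=
  ∑ a ∈ A, I.armHardness u i A a

end CacoInput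

end

/-!
The deterministic half of the proof concerns runs whose estimates are accurate at every check of
the stopping rule. Accuracy is the condition `PairAccurate` on *pairs*: the errors `|û a - u a|`
and `|û b - u b|` of two distinct active arms together are at most `rad a + rad b`. Pairing the
arms of the optimal cohort outside the output with those of the output outside the optimal cohort
shows that a stage ends with an `ε`-optimal cohort (`CheckData.sub_lt`). Exchange arguments show
that an arm that is pulled after the initial batch has radius at least `ε / (2 K)` and at least an
eighth of its gap (`CheckData.eps_le`, `CheckData.exists_exchange`), so that its information is at
most `128 σ² log (4 n Cost³ / δ)` times its hardness. Summing over the arms bounds the cost by its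
own logarithm; hence the run halts (`exists_halted`), and the total cost can be eliminated from
the logarithms (`cost_le_of_implicit`). The last step uses that there are at least quadratically
many mandatory pulls in the number of stages.

The probabilistic half (`measure_not_pairAccurate_le`) shows that accuracy fails with probability
at most `δ`. For a fixed direction `l`, the exponential of
`∑ a, (l a * S a - l a ^ 2 * σ ^ 2 * V a / 2)` has expectation at most `1` at every time, where
`S a` is the centered weighted reward sum of arm `a` and `V a` its information. The difficulty is
that the information of an arm is a random combination of the gains of the stages: a union bound
over its values is too expensive, and the radii leave no room for covering them by a grid as long
as `|û a - u a| ≤ rad a` is asked of every single arm. The pair condition leaves room. After `N`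
pulls, `V a` lies between the largest gain `v` of the stages so far and `N * v`, so that radii
differ by a factor of at most `√N`. A pair can thus violate the condition only if one arm deviates
by `1 + 1 / (8 √N)` radii or both arms deviate by `7 / 8` of their radii. In the first case the
surplus allows `V a` to be replaced by the nearest point of a geometric grid with only about `√N`
points without any loss in the exponent; in the second case the exponent is `4 / 3` times as
large, and a grid of ratio `4` suffices. The sum over the number `N` of pulls, over the stages
that can be running after `N` pulls (fewer than `√(2 N)`), over the arms, and over the grid points
is at most `δ`. At a check the time is determined by `N` and the stage, so that no maximal
inequality is needed.
-/

section

open Finset MeasureTheory ProbabilityTheory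

/-! ### Exchange arguments at a check of the stopping rule -/

/-- `M` maximizes `w(v, ·)` over the `K`-element subsets of `A`. -/
def IsBestCohort {n : ℕ} (v : Fin n → ℝ) (A : Finset (Fin n)) (K : ℕ) (M : Finset (Fin n)) : Prop :=
  M ∈ A.powersetCard K ∧ ∀ M' ∈ A.powersetCard K, cohortValue v M' ≤ cohortValue v M

theorem IsMaxOracle.isBestCohort {n : ℕ}
    {oracle : ℕ → (Fin n → ℝ) → Finset (Fin n) → Finset (Fin n)} (h : IsMaxOracle oracle)
    {K : ℕ} (v : Fin n → ℝ) {A : Finset (Fin n)} (hK : K ≤ A.card) :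
    IsBestCohort v A K (oracle K v A) :=
  ⟨h.mem K v A hK, h.le K v A hK⟩

theorem swap_mem_powersetCard {n K : ℕ} {A M : Finset (Fin n)} (hM : M ∈ A.powersetCard K)
    {a b : Fin n} (ha : a ∈ M) (hb : b ∈ A) (hbM : b ∉ M) :
    insert b (M.erase a) ∈ A.powersetCard K := by
  rw [mem_powersetCard] at hM ⊢
  refine ⟨insert_subset hb ((erase_subset _ _).trans hM.1), ?_⟩
  rw [card_insert_of_notMem (fun h => hbM (mem_of_mem_erase h)), card_erase_add_one ha, hM.2]

theorem cohortValue_swap {n : ℕ} (v : Fin n → ℝ) {M : Finset (Fin n)} {a b : Fin n}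
    (ha : a ∈ M) (hbM : b ∉ M) :
    cohortValue v (insert b (M.erase a)) = cohortValue v M - v a + v b := by
  unfold cohortValue
  rw [sum_insert (fun h => hbM (mem_of_mem_erase h)), ← add_sum_erase M v ha]
  ring

/-- An arm outside a best cohort is no better than an arm inside. -/
theorem IsBestCohort.le_of_mem {n K : ℕ} {v : Fin n → ℝ} {A M : Finset (Fin n)}
    (h : IsBestCohort v A K M) {a b : Fin n} (ha : a ∈ M) (hb : b ∈ A) (hbM : b ∉ M) :
    v b ≤ v a := by
  have := h.2 _ (swap_mem_powersetCard h.1 ha hb hbM)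
  rw [cohortValue_swap v ha hbM] at this
  linarith

theorem exists_mem_sdiff {n K : ℕ} {A M M' : Finset (Fin n)} (hM : M ∈ A.powersetCard K)
    (hM' : M' ∈ A.powersetCard K) {p : Fin n} (hp : p ∈ M) (hp' : p ∉ M') :
    ∃ q ∈ M', q ∉ M := by
  rw [mem_powersetCard] at hM hM'
  by_contra! hcon
  have hsub : M' ⊆ M := hcon
  have := eq_of_subset_of_card_le hsub (by rw [hM.2, hM'.2])
  exact hp' (this ▸ hp)

theorem cohortValue_sub {n : ℕ} (v : Fin n → ℝ) (M N : Finset (Fin n)) :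
    cohortValue v M - cohortValue v N = ∑ a ∈ M \ N, v a - ∑ a ∈ N \ M, v a := by
  unfold cohortValue
  rw [← sum_sdiff_sub_sum_sdiff]

theorem card_sdiff_eq {n K : ℕ} {A M M' : Finset (Fin n)} (hM : M ∈ A.powersetCard K)
    (hM' : M' ∈ A.powersetCard K) : (M \ M').card = (M' \ M).card := by
  rw [mem_powersetCard] at hM hM'
  exact card_sdiff_comm (hM.2.trans hM'.2.symm)

/-- If `g a + g b ≤ 0` for all distinct `a`, `b`, the sum of `g` over two disjoint sets of equal
size is nonpositive: average over all pairs. -/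
theorem sum_add_sum_nonpos {n : ℕ} (g : Fin n → ℝ) {U V : Finset (Fin n)}
    (hc : U.card = V.card) (h : ∀ a ∈ U, ∀ b ∈ V, g a + g b ≤ 0) :
    ∑ a ∈ U, g a + ∑ b ∈ V, g b ≤ 0 := by
  rcases U.eq_empty_or_nonempty with rfl | hU
  · have : V = ∅ := card_eq_zero.mp (by rw [← hc, card_empty])
    simp [this]
  · have h1 : ∑ a ∈ U, ∑ b ∈ V, (g a + g b) ≤ 0 :=
      sum_nonpos fun a ha => sum_nonpos fun b hb => h a ha b hb
    have h2 : ∑ a ∈ U, ∑ b ∈ V, (g a + g b) = U.card * (∑ a ∈ U, g a + ∑ b ∈ V, g b) := by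
      simp_rw [sum_add_distrib, sum_const, nsmul_eq_mul]
      rw [← mul_sum, ← hc, mul_add]
    rw [h2] at h1
    have hpos : (0 : ℝ) < U.card := by exact_mod_cast card_pos.mpr hU
    exact nonpos_of_mul_nonpos_right h1 hpos

/-- The situation of one check of the stopping rule: empirical means `û`, radii `r`, empirically
best cohort `M`, pessimistic estimates `ũ` with best cohort `M'`, and true utilities `u` with best
cohort `Mo`. The accuracy assumption `pair` is about pairs of arms: the errors of two arms together
are at most the sum of their radii. -/
structure CheckData {n : ℕ} (A : Finset (Fin n)) (K : ℕ) (u û r : Fin n → ℝ)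
    (M M' Mo : Finset (Fin n)) : Prop where
  best : IsBestCohort û A K M
  best' : IsBestCohort (fun a => if a ∈ M then û a - r a else û a + r a) A K M'
  besto : IsBestCohort u A K Mo
  nonneg : ∀ a, 0 ≤ r a
  pair : ∀ a ∈ A, ∀ b ∈ A, a ≠ b → |û a - u a| + |û b - u b| ≤ r a + r b

namespace CheckData

variable {n : ℕ} {A : Finset (Fin n)} {K : ℕ} {u û r : Fin n → ℝ} {M M' Mo : Finset (Fin n)}

/-- If the stopping rule holds, the empirically best cohort is `ε`-optimal. The errors are paired
along the symmetric difference of the two cohorts. -/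
theorem sub_lt (h : CheckData A K u û r M M' Mo) {ε : ℝ}
    (hε : |cohortValue (fun a => if a ∈ M then û a - r a else û a + r a) M' -
      cohortValue (fun a => if a ∈ M then û a - r a else û a + r a) M| < ε) :
    |cohortValue u M - cohortValue u Mo| < ε := by
  set w : Fin n → ℝ := fun a => if a ∈ M then û a - r a else û a + r a with hw
  have h1 : cohortValue u M ≤ cohortValue u Mo := h.besto.2 _ h.best.1
  have h2 : cohortValue w Mo ≤ cohortValue w M' := h.best'.2 _ h.besto.1
  have h3 := (abs_lt.mp hε).2
  have hMA := (mem_powersetCard.mp h.best.1).1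
  have hMoA := (mem_powersetCard.mp h.besto.1).1
  have h4 : (cohortValue u Mo - cohortValue u M) ≤ (cohortValue w Mo - cohortValue w M) := by
    rw [cohortValue_sub, cohortValue_sub]
    have e1 : ∑ a ∈ Mo \ M, u a ≤ ∑ a ∈ Mo \ M, w a + ∑ a ∈ Mo \ M, (|û a - u a| - r a) := by
      rw [← sum_add_distrib]
      refine sum_le_sum fun a ha => ?_
      have : a ∉ M := (mem_sdiff.mp ha).2
      simp only [hw, this, if_false]
      linarith [neg_abs_le (û a - u a)]
    have e2 : ∑ a ∈ M \ Mo, w a ≤ ∑ a ∈ M \ Mo, u a + ∑ a ∈ M \ Mo, (|û a - u a| - r a) := by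
      rw [← sum_add_distrib]
      refine sum_le_sum fun a ha => ?_
      have : a ∈ M := (mem_sdiff.mp ha).1
      simp only [hw, this, if_true]
      linarith [le_abs_self (û a - u a)]
    have e3 := sum_add_sum_nonpos (fun a => |û a - u a| - r a)
      (card_sdiff_eq h.besto.1 h.best.1) (fun a ha b hb => by
        obtain ⟨ha1, ha2⟩ := mem_sdiff.mp ha
        obtain ⟨hb1, hb2⟩ := mem_sdiff.mp hb
        have := h.pair a (hMoA ha1) b (hMA hb1) (fun e => ha2 (e ▸ hb1))
        linarith)
    linarith
  rw [abs_lt]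
  constructor <;> linarith

/-- If the stopping rule fails, the arm of largest radius in the symmetric difference has radius at
least `ε / (2 K)`. -/
theorem eps_le (h : CheckData A K u û r M M' Mo) {ε : ℝ}
    (hε : ¬ |cohortValue (fun a => if a ∈ M then û a - r a else û a + r a) M' -
      cohortValue (fun a => if a ∈ M then û a - r a else û a + r a) M| < ε)
    {p : Fin n} (hp : ∀ b ∈ (M' \ M) ∪ (M \ M'), r b ≤ r p) :
    ε ≤ 2 * K * r p := by
  set w : Fin n → ℝ := fun a => if a ∈ M then û a - r a else û a + r a with hw
  have h1 : cohortValue û M' - cohortValue û M ≤ 0 := by linarith [h.best.2 _ h.best'.1]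
  have h2 : cohortValue w M ≤ cohortValue w M' := h.best'.2 _ h.best.1
  rw [not_lt, abs_of_nonneg (by linarith)] at hε
  rw [cohortValue_sub] at hε h1
  have e1 : ∑ a ∈ M' \ M, w a ≤ ∑ a ∈ M' \ M, û a + (M' \ M).card * r p := by
    rw [← nsmul_eq_mul, ← sum_const, ← sum_add_distrib]
    refine sum_le_sum fun a ha => ?_
    simp only [hw, (mem_sdiff.mp ha).2, if_false]
    linarith [hp a (mem_union_left _ ha)]
  have e2 : ∑ a ∈ M \ M', û a ≤ ∑ a ∈ M \ M', w a + (M \ M').card * r p := by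
    rw [← nsmul_eq_mul, ← sum_const, ← sum_add_distrib]
    refine sum_le_sum fun a ha => ?_
    simp only [hw, (mem_sdiff.mp ha).1, if_true]
    linarith [hp a (mem_union_right _ ha)]
  have c1 : ((M' \ M).card : ℝ) ≤ K := by
    rw [← (mem_powersetCard.mp h.best'.1).2]; exact_mod_cast card_le_card sdiff_subset
  have c2 : ((M \ M').card : ℝ) ≤ K := by
    rw [← (mem_powersetCard.mp h.best.1).2]; exact_mod_cast card_le_card sdiff_subset
  nlinarith [mul_le_mul_of_nonneg_right c1 (h.nonneg p), mul_le_mul_of_nonneg_right c2 (h.nonneg p)]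

/-- The arm `p` of largest radius in the symmetric difference can be on the wrong side of the
optimal cohort only by an exchange whose value is at most `8 r p`. -/
theorem exists_exchange (h : CheckData A K u û r M M' Mo) {p : Fin n}
    (hpD : p ∈ (M' \ M) ∪ (M \ M')) (hp : ∀ b ∈ (M' \ M) ∪ (M \ M'), r b ≤ r p) :
    (p ∈ Mo → ∃ q ∈ A, q ∉ Mo ∧ u p - u q ≤ 8 * r p) ∧
      (p ∉ Mo → ∃ q ∈ Mo, u q - u p ≤ 8 * r p) := by
  set w : Fin n → ℝ := fun a => if a ∈ M then û a - r a else û a + r a with hw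
  have hMA := (mem_powersetCard.mp h.best.1).1
  have hM'A := (mem_powersetCard.mp h.best'.1).1
  have hMoA := (mem_powersetCard.mp h.besto.1).1
  have hpA : p ∈ A := by
    rcases mem_union.mp hpD with hh | hh
    · exact hM'A (mem_sdiff.mp hh).1
    · exact hMA (mem_sdiff.mp hh).1
  have hwin : ∀ a ∈ M, w a = û a - r a := fun a ha => by simp [hw, ha]
  have hwout : ∀ a, a ∉ M → w a = û a + r a := fun a ha => by simp [hw, ha]
  -- every other active arm has error at most its radius plus the radius of `p`
  have hdev : ∀ a ∈ A, a ≠ p → |û a - u a| ≤ r a + r p := fun a ha hap => by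
    linarith [h.pair a ha p hpA hap, abs_nonneg (û p - u p)]
  have hD' : ∀ a ∈ M', a ∉ M → r a ≤ r p := fun a h1 h2 =>
    hp a (mem_union_left _ (mem_sdiff.mpr ⟨h1, h2⟩))
  have hD : ∀ a ∈ M, a ∉ M' → r a ≤ r p := fun a h1 h2 =>
    hp a (mem_union_right _ (mem_sdiff.mpr ⟨h1, h2⟩))
  have hr := h.nonneg p
  have hdevp : |û p - u p| ≤ 2 * r p := by
    rcases mem_union.mp hpD with hh | hh
    · obtain ⟨f, hf, hf'⟩ := exists_mem_sdiff h.best'.1 h.best.1 (mem_sdiff.mp hh).1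
        (mem_sdiff.mp hh).2
      have := h.pair p hpA f (hMA hf) (fun e => (mem_sdiff.mp hh).2 (e ▸ hf))
      linarith [abs_nonneg (û f - u f), hD f hf hf']
    · obtain ⟨f, hf, hf'⟩ := exists_mem_sdiff h.best.1 h.best'.1 (mem_sdiff.mp hh).1
        (mem_sdiff.mp hh).2
      have := h.pair p hpA f (hM'A hf) (fun e => (mem_sdiff.mp hh).2 (e ▸ hf))
      linarith [abs_nonneg (û f - u f), hD' f hf hf']
  have hdp := abs_le.mp hdevp
  have hdev' : ∀ a ∈ A, a ≠ p → -(r a + r p) ≤ û a - u a ∧ û a - u a ≤ r a + r p :=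
    fun a ha hap => abs_le.mp (hdev a ha hap)
  rcases mem_union.mp hpD with hh | hh <;> obtain ⟨hp1, hp2⟩ := mem_sdiff.mp hh
  · constructor
    · intro hpo
      obtain ⟨q, hqM, hqo⟩ := exists_mem_sdiff h.besto.1 h.best.1 hpo hp2
      have hqA := hMA hqM
      refine ⟨q, hqA, hqo, ?_⟩
      have hqp : q ≠ p := fun e => hqo (e ▸ hpo)
      have b1 := h.best.le_of_mem hqM hpA hp2
      have dq := hdev' q hqA hqp
      by_cases hqM' : q ∈ M'
      · obtain ⟨f, hf, hf'⟩ := exists_mem_sdiff h.best'.1 h.best.1 hp1 hp2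
        have b2 := h.best.le_of_mem hf hpA hp2
        have b3 := h.best'.le_of_mem hqM' (hMA hf) hf'
        change w f ≤ w q at b3
        rw [hwin f hf, hwin q hqM] at b3
        linarith [hD f hf hf']
      · linarith [hD q hqM hqM']
    · intro hpo
      obtain ⟨e, heo, heM'⟩ := exists_mem_sdiff h.best'.1 h.besto.1 hp1 hpo
      have heA := hMoA heo
      refine ⟨e, heo, ?_⟩
      have hep : e ≠ p := fun E => hpo (E ▸ heo)
      have b1 := h.best'.le_of_mem hp1 heA heM'
      change w e ≤ w p at b1
      rw [hwout p hp2] at b1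
      have de := hdev' e heA hep
      by_cases heM : e ∈ M
      · rw [hwin e heM] at b1
        linarith [hD e heM heM']
      · rw [hwout e heM] at b1
        linarith
  · constructor
    · intro hpo
      obtain ⟨q, hqM', hqo⟩ := exists_mem_sdiff h.besto.1 h.best'.1 hpo hp2
      have hqA := hM'A hqM'
      refine ⟨q, hqA, hqo, ?_⟩
      have hqp : q ≠ p := fun e => hqo (e ▸ hpo)
      have b1 := h.best'.le_of_mem hqM' hpA hp2
      change w p ≤ w q at b1
      rw [hwin p hp1] at b1
      have dq := hdev' q hqA hqp
      by_cases hqM : q ∈ M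
      · rw [hwin q hqM] at b1
        linarith
      · rw [hwout q hqM] at b1
        linarith [hD' q hqM' hqM]
    · intro hpo
      obtain ⟨e, heo, heM⟩ := exists_mem_sdiff h.best.1 h.besto.1 hp1 hpo
      have heA := hMoA heo
      refine ⟨e, heo, ?_⟩
      have hep : e ≠ p := fun E => hpo (E ▸ heo)
      have b1 := h.best.le_of_mem hp1 heA heM
      have de := hdev' e heA hep
      by_cases heM' : e ∈ M'
      · linarith [hD' e heM' heM]
      · obtain ⟨f, hf, hf'⟩ := exists_mem_sdiff h.best.1 h.best'.1 hp1 hp2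
        have b2 := h.best.le_of_mem hp1 (hM'A hf) hf'
        have b3 := h.best'.le_of_mem hf heA heM'
        change w e ≤ w f at b3
        rw [hwout e heM, hwout f hf'] at b3
        linarith [hD' f hf hf']

end CheckData

namespace CacoInput

variable {n : ℕ} {I : CacoInput n} {u : Fin n → ℝ} {i : ℕ} {A : Finset (Fin n)}

theorem isBestCohort_optimal (hI : IsMaxOracle I.oracle) (hA : I.K (i + 1) ≤ A.card) :
    IsBestCohort u A (I.K (i + 1)) (I.optimal u i A) :=
  hI.isBestCohort u hA

theorem gap_nonneg (hI : IsMaxOracle I.oracle) (hA : I.K (i + 1) < A.card)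
    (hK : 1 ≤ I.K (i + 1)) {a : Fin n} (ha : a ∈ A) : 0 ≤ I.gap u i A a := by
  have hbest : IsBestCohort u A (I.K (i + 1)) (I.optimal u i A) := isBestCohort_optimal hI hA.le
  unfold gap
  split_ifs with h
  · refine sub_nonneg.mpr (csSup_le ?_ ?_)
    · obtain ⟨M, hM, hMc⟩ := exists_subset_card_eq (s := A.erase a) (n := I.K (i + 1))
        (by rw [card_erase_of_mem ha]; omega)
      exact ⟨_, M, ⟨mem_powersetCard.mpr ⟨hM.trans (erase_subset _ _), hMc⟩,
        fun h => notMem_erase a A (hM h)⟩, rfl⟩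
    · rintro _ ⟨M, hM, rfl⟩
      exact hbest.2 M hM.1
  · refine sub_nonneg.mpr (csSup_le ?_ ?_)
    · obtain ⟨M, hM, hM2, hMc⟩ := exists_subsuperset_card_eq (s := {a}) (t := A)
        (n := I.K (i + 1)) (singleton_subset_iff.mpr ha) (by simpa using hK) hA.le
      exact ⟨_, M, ⟨mem_powersetCard.mpr ⟨hM2, hMc⟩, hM (mem_singleton_self a)⟩, rfl⟩
    · rintro _ ⟨M, hM, rfl⟩
      exact hbest.2 M hM.1

theorem gap_le_of_mem (hI : IsMaxOracle I.oracle) (hA : I.K (i + 1) ≤ A.card) {p q : Fin n}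
    (hp : p ∈ I.optimal u i A) (hq : q ∈ A) (hqo : q ∉ I.optimal u i A) :
    I.gap u i A p ≤ u p - u q := by
  have hbest : IsBestCohort u A (I.K (i + 1)) (I.optimal u i A) := isBestCohort_optimal hI hA
  unfold gap
  rw [if_pos hp]
  have hne : p ≠ q := fun e => hqo (e ▸ hp)
  have hfin : (cohortValue u '' {M | M ∈ A.powersetCard (I.K (i + 1)) ∧ p ∉ M}).Finite :=
    (((A.powersetCard (I.K (i + 1))).finite_toSet).subset fun M hM => hM.1).image _
  have := le_csSup hfin.bddAbove ⟨insert q ((I.optimal u i A).erase p),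
    ⟨swap_mem_powersetCard hbest.1 hp hq hqo, by simp [hne]⟩, rfl⟩
  rw [cohortValue_swap u hp hqo] at this
  linarith

theorem gap_le_of_notMem (hI : IsMaxOracle I.oracle) (hA : I.K (i + 1) ≤ A.card) {p q : Fin n}
    (hp : p ∉ I.optimal u i A) (hpA : p ∈ A) (hqo : q ∈ I.optimal u i A) :
    I.gap u i A p ≤ u q - u p := by
  have hbest : IsBestCohort u A (I.K (i + 1)) (I.optimal u i A) := isBestCohort_optimal hI hA
  unfold gap
  rw [if_neg hp]
  have hfin : (cohortValue u '' {M | M ∈ A.powersetCard (I.K (i + 1)) ∧ p ∈ M}).Finite :=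
    (((A.powersetCard (I.K (i + 1))).finite_toSet).subset fun M hM => hM.1).image _
  have := le_csSup hfin.bddAbove ⟨insert p ((I.optimal u i A).erase q),
    ⟨swap_mem_powersetCard hbest.1 hqo hpA hp, mem_insert_self _ _⟩, rfl⟩
  rw [cohortValue_swap u hqo hp] at this
  linarith

/-- A radius that is at least an eighth of the gap and at least `ε / (2 K)` is large compared with
the hardness of the arm. -/
theorem one_le_armHardness_mul_sq {a : Fin n} {r : ℝ} (hε : 0 < I.ε)
    (hgap : 0 ≤ I.gap u i A a) (h1 : I.gap u i A a ≤ 8 * r)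
    (h2 : I.ε ≤ 2 * I.K (i + 1) * r) : 1 ≤ 64 * I.armHardness u i A a * r ^ 2 := by
  have hb : 1 ≤ 64 * ((I.K (i + 1) : ℝ) ^ 2 / I.ε ^ 2) * r ^ 2 := by
    have : I.ε ^ 2 ≤ (2 * I.K (i + 1) * r) ^ 2 := pow_le_pow_left₀ hε.le h2 2
    rw [mul_div_assoc', div_mul_eq_mul_div, le_div_iff₀ (by positivity)]
    nlinarith [sq_nonneg ((I.K (i + 1) : ℝ) * r)]
  unfold armHardness
  split_ifs with h0
  · exact hb
  · have hpos : 0 < I.gap u i A a := lt_of_le_of_ne hgap (Ne.symm h0)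
    have ha : 1 ≤ 64 * (1 / I.gap u i A a ^ 2) * r ^ 2 := by
      have := pow_le_pow_left₀ hgap h1 2
      rw [mul_one_div, div_mul_eq_mul_div, le_div_iff₀ (by positivity)]
      nlinarith
    rcases min_choice (1 / I.gap u i A a ^ 2) ((I.K (i + 1) : ℝ) ^ 2 / I.ε ^ 2) with h | h <;>
      rw [h] <;> assumption

theorem armHardness_nonneg (a : Fin n) : 0 ≤ I.armHardness u i A a := by
  unfold armHardness
  split_ifs <;> positivity

theorem armHardness_le (a : Fin n) :
    I.armHardness u i A a ≤ (I.K (i + 1) : ℝ) ^ 2 / I.ε ^ 2 := by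
  unfold armHardness
  split_ifs
  · exact le_rfl
  · exact min_le_right _ _

theorem stageHardness_nonneg : 0 ≤ I.stageHardness u i A :=
  sum_nonneg fun a _ => armHardness_nonneg a

theorem stageHardness_le : I.stageHardness u i A ≤ n * ((I.K (i + 1) : ℝ) ^ 2 / I.ε ^ 2) := by
  unfold stageHardness
  refine (sum_le_sum fun a _ => armHardness_le a).trans ?_
  rw [sum_const, nsmul_eq_mul]
  refine mul_le_mul_of_nonneg_right ?_ (by positivity)
  exact_mod_cast (card_le_univ A).trans_eq (Fintype.card_fin n)

end CacoInput

/-! ### Bookkeeping along a run -/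

namespace CacoInput

variable {n : ℕ} {I : CacoInput n}

theorem step_halted {st : CacoState n} (x : ℕ → Fin n → ℝ) (h : I.m ≤ st.stage) :
    I.step x st = st := by
  simp [step, h]

theorem step_fresh {st : CacoState n} (x : ℕ → Fin n → ℝ) (h : st.stage < I.m)
    (hf : st.fresh = true) :
    I.step x st = { st.pull (st.active st.stage) (I.s st.stage) (x st.stage)
      ((I.K st.stage : ℝ) * I.j st.stage) with fresh := false } := by
  simp [step, h.not_ge, hf]

theorem step_close {st : CacoState n} (x : ℕ → Fin n → ℝ) (h : st.stage < I.m)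
    (hf : st.fresh = false) (hc : I.closeEnough st) :
    I.step x st = { st with
      stage := st.stage + 1
      fresh := true
      active := Function.update st.active (st.stage + 1) (I.empBest st) } := by
  simp [step, h.not_ge, hf, hc]

theorem step_pull {st : CacoState n} (x : ℕ → Fin n → ℝ) (h : st.stage < I.m)
    (hf : st.fresh = false) (hc : ¬ I.closeEnough st) :
    I.step x st =
      st.pull {I.nextArm st} (I.s st.stage) (x st.stage) (I.j st.stage) := by
  simp [step, h.not_ge, hf, hc]

/-- An induction principle along a run: a property of the time and the state holds throughout if it
holds at the start and is preserved by each of the three kinds of step. -/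
theorem run_induction (x : ℕ → ℕ → Fin n → ℝ) {p : ℕ → CacoState n → Prop}
    (zero : p 0 (start n))
    (halted : ∀ t, I.m ≤ (I.run x t).stage → p t (I.run x t) → p (t + 1) (I.run x t))
    (fresh : ∀ t, ∀ st, st = I.run x t → st.stage < I.m → st.fresh = true → p t st →
      p (t + 1) { st.pull (st.active st.stage) (I.s st.stage) (x t st.stage)
        ((I.K st.stage : ℝ) * I.j st.stage) with fresh := false })
    (close : ∀ t, ∀ st, st = I.run x t → st.stage < I.m → st.fresh = false → I.closeEnough st →
      p t st → p (t + 1) { st with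
        stage := st.stage + 1
        fresh := true
        active := Function.update st.active (st.stage + 1) (I.empBest st) })
    (pull : ∀ t, ∀ st, st = I.run x t → st.stage < I.m → st.fresh = false → ¬ I.closeEnough st →
      p t st →
      p (t + 1) (st.pull {I.nextArm st} (I.s st.stage) (x t st.stage) (I.j st.stage)))
    (t : ℕ) : p t (I.run x t) := by
  induction t with
  | zero => exact zero
  | succ t ih =>
    change p (t + 1) (I.step (x t) (I.run x t))
    by_cases h : I.m ≤ (I.run x t).stage
    · rw [step_halted _ h]
      exact halted t h ih
    · rw [not_le] at h
      by_cases hf : (I.run x t).fresh = true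
      · rw [step_fresh _ h hf]
        exact fresh t _ rfl h hf ih
      · rw [Bool.not_eq_true] at hf
        by_cases hc : I.closeEnough (I.run x t)
        · rw [step_close _ h hf hc]
          exact close t _ rfl h hf hc ih
        · rw [step_pull _ h hf hc]
          exact pull t _ rfl h hf hc ih

/-- The number of mandatory pulls in the first `k` stages. -/
def firstPulls (I : CacoInput n) (k : ℕ) : ℕ := ∑ l ∈ range k, I.K l

/-- The largest information gain of a pull in the stages `0, …, i`. -/
def maxGain (I : CacoInput n) (i : ℕ) : ℝ := (range (i + 1)).sup' nonempty_range_add_one I.s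

theorem le_maxGain {l i : ℕ} (h : l ≤ i) : I.s l ≤ I.maxGain i :=
  le_sup' I.s (mem_range.mpr (by omega))

theorem maxGain_mono {i k : ℕ} (h : i ≤ k) : I.maxGain i ≤ I.maxGain k :=
  sup'_mono I.s (range_mono (by omega)) _

theorem maxGain_pos (hI : I.Valid) (i : ℕ) : 0 < I.maxGain i :=
  (hI.s_pos 0 hI.m_pos).trans_le (le_maxGain (Nat.zero_le i))

theorem maxGain_le {i : ℕ} {c : ℝ} (h : ∀ l ≤ i, I.s l ≤ c) : I.maxGain i ≤ c :=
  sup'_le _ _ fun l hl => h l (by rw [mem_range] at hl; omega)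

namespace Valid

theorem add_le_K (hI : I.Valid) {i : ℕ} (hi : i ≤ I.m) : I.m - i + 1 ≤ I.K i := by
  obtain ⟨d, hd⟩ := Nat.exists_eq_add_of_le hi
  induction d generalizing i with
  | zero => rw [show i = I.m by omega]; simpa using hI.K_last
  | succ d ih =>
    have h1 := ih (i := i + 1) (by omega) (by omega)
    have h2 := hI.K_lt i (by omega)
    omega

theorem one_le_K (hI : I.Valid) {i : ℕ} (hi : i ≤ I.m) : 1 ≤ I.K i := by
  have := hI.add_le_K hi
  omega

theorem two_le_K (hI : I.Valid) {i : ℕ} (hi : i < I.m) : 2 ≤ I.K i := by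
  have := hI.add_le_K hi.le
  omega

theorem two_le_n (hI : I.Valid) : 2 ≤ n := by
  have := hI.two_le_K hI.m_pos
  rwa [hI.K_zero] at this

theorem K_le_n (hI : I.Valid) {i : ℕ} (hi : i ≤ I.m) : I.K i ≤ n := by
  induction i with
  | zero => exact hI.K_zero.le
  | succ i ih => exact (hI.K_lt i hi).le.trans (ih (by omega))

/-- The mandatory pulls alone are at least quadratic in the number of stages. -/
theorem sq_le_firstPulls (hI : I.Valid) {i : ℕ} (hi : i < I.m) :
    (i + 2) ^ 2 ≤ 2 * I.firstPulls (i + 1) := by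
  have key : ∀ k ≤ i + 1, k * (2 * (i + 1 - k) + k + 3) ≤ 2 * I.firstPulls k := by
    intro k hk
    induction k with
    | zero => simp
    | succ k ih =>
      have h1 := ih (by omega)
      have h2 := hI.add_le_K (i := k) (by omega)
      have h3 : I.firstPulls (k + 1) = I.firstPulls k + I.K k := sum_range_succ _ _
      obtain ⟨d, hd⟩ := Nat.exists_eq_add_of_le hk
      have e1 : i + 1 - (k + 1) = d := by omega
      have e2 : i + 1 - k = d + 1 := by omega
      rw [e1]
      rw [e2] at h1
      have h4 : d + 2 ≤ I.K k := by omega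
      rw [h3]
      nlinarith
  have := key (i + 1) le_rfl
  simp only [Nat.sub_self] at this
  nlinarith

theorem n_le_firstPulls (hI : I.Valid) (i : ℕ) : n ≤ I.firstPulls (i + 1) := by
  conv_lhs => rw [← hI.K_zero]
  exact single_le_sum (f := I.K) (fun _ _ => Nat.zero_le _) (mem_range.mpr (by omega))

end Valid

/-- Bookkeeping facts about the state at time `t`. In `count`, `N` is the number of pulls so
far; before the algorithm halts it is determined by the time and the stage, since every step except
the batches and the stage ends is one pull. -/
structure RunInv (I : CacoInput n) (t : ℕ) (st : CacoState n) : Prop where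
  stage_le : st.stage ≤ I.m
  fresh_of_halted : st.stage = I.m → st.fresh = true
  card : ∀ l ≤ st.stage, (st.active l).card = I.K l
  info_ge : ∀ l, l < st.stage ∨ (l = st.stage ∧ st.fresh = false) →
    ∀ a ∈ st.active st.stage, I.s l ≤ st.info a
  info_nonneg : ∀ a, 0 ≤ st.info a
  count : st.stage < I.m → ∃ e N : ℕ, t = 2 * st.stage + (if st.fresh then 0 else 1) + e ∧
    N = I.firstPulls (st.stage + if st.fresh then 0 else 1) + e ∧ (N : ℝ) ≤ st.cost ∧
    ∀ a, st.info a ≤ N * I.maxGain st.stage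
  n_le_cost : st.fresh = false ∨ 0 < st.stage → (n : ℝ) ≤ st.cost

theorem empBest_mem (hI : I.Valid) {st : CacoState n} (hs : st.stage < I.m)
    (hc : (st.active st.stage).card = I.K st.stage) :
    I.empBest st ∈ (st.active st.stage).powersetCard (I.K (st.stage + 1)) :=
  hI.oracle_max.mem _ _ _ (by rw [hc]; exact (hI.K_lt _ hs).le)

theorem runInv (hI : I.Valid) (x : ℕ → ℕ → Fin n → ℝ) (t : ℕ) : I.RunInv t (I.run x t) := by
  refine run_induction x (p := fun t st => I.RunInv t st) ?_ ?_ ?_ ?_ ?_ t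
  · refine ⟨Nat.zero_le _, fun h => rfl, ?_, ?_, fun a => le_rfl, ?_, ?_⟩
    · intro l hl
      have : l = 0 := Nat.le_zero.mp hl
      subst this
      simp [start, hI.K_zero]
    · intro l hl
      simp [start] at hl
    · intro _
      exact ⟨0, 0, by simp [start], by simp [start, firstPulls], by simp [start], by simp [start]⟩
    · intro h
      simp [start] at h
  · intro t h ih
    exact ⟨ih.1, ih.2, ih.3, ih.4, ih.5, fun h' => absurd h' (by omega), ih.7⟩
  · intro t st _ hs hf ih
    have hsp := hI.s_pos _ hs
    have hgain : I.s st.stage ≤ I.maxGain st.stage := le_maxGain le_rfl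
    have hK := hI.one_le_K hs.le
    have hj := hI.j_ge _ hs
    have hcount := ih.count hs
    have hKj : (I.K st.stage : ℝ) ≤ I.K st.stage * I.j st.stage :=
      le_mul_of_one_le_right (Nat.cast_nonneg _) hj
    obtain ⟨e, N, h1, h2, h3, h4⟩ := hcount
    simp only [hf, if_true, add_zero] at h1 h2
    have hN : I.firstPulls (st.stage + 1) + e = N + I.K st.stage := by
      rw [h2]; unfold firstPulls; rw [sum_range_succ]; omega
    have hcost : (((N + I.K st.stage : ℕ)) : ℝ) ≤ st.cost + I.K st.stage * I.j st.stage := by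
      push_cast; linarith
    refine ⟨hs.le, fun h => absurd h hs.ne, ih.card, ?_, ?_, ?_, ?_⟩
    · rintro l (hl | ⟨rfl, _⟩) a ha
      · have := ih.info_ge l (Or.inl hl) a ha
        simp only [CacoState.pull] at ha ⊢
        rw [if_pos ha]; linarith
      · have := ih.info_nonneg a
        simp only [CacoState.pull] at ha ⊢
        rw [if_pos ha]; linarith
    · intro a
      have := ih.info_nonneg a
      simp only [CacoState.pull]
      split_ifs <;> linarith
    · intro _
      refine ⟨e, N + I.K st.stage, ?_, ?_, hcost, ?_⟩
      · simp only [CacoState.pull]; simp; omega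
      · simp only [CacoState.pull]; simp [hN]
      · intro a
        have h5 := h4 a
        have hK' : (1 : ℝ) ≤ I.K st.stage := by exact_mod_cast hK
        have hg := maxGain_pos hI st.stage
        simp only [CacoState.pull]
        push_cast
        split_ifs <;> nlinarith
    · intro _
      refine le_trans ?_ hcost
      rw [← hN]
      exact_mod_cast (hI.n_le_firstPulls _).trans (Nat.le_add_right _ _)
  · intro t st _ hs hf _ ih
    have hmem := mem_powersetCard.mp (empBest_mem hI hs (ih.card _ le_rfl))
    refine ⟨hs, fun _ => rfl, ?_, ?_, ih.info_nonneg, ?_, ?_⟩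
    · intro l hl
      simp only at hl ⊢
      rcases Nat.lt_or_ge st.stage l with h | h
      · have : l = st.stage + 1 := by omega
        subst this
        rw [Function.update_self]
        exact hmem.2
      · rw [Function.update_of_ne (by omega)]
        exact ih.card l h
    · rintro l hl a ha
      simp only [Function.update_self] at hl ha ⊢
      refine ih.info_ge l ?_ a (hmem.1 ha)
      rcases hl with hl | hl
      · rcases Nat.lt_or_ge l st.stage with h | h
        · exact Or.inl h
        · exact Or.inr ⟨by omega, hf⟩
      · exact absurd hl.2 (by simp)
    · intro _
      obtain ⟨e, N, h1, h2, h3, h4⟩ := ih.count hs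
      simp only [hf] at h1 h2
      refine ⟨e, N, ?_, ?_, h3, fun a => (h4 a).trans ?_⟩
      · simp at h1 ⊢; omega
      · simpa using h2
      · exact mul_le_mul_of_nonneg_left (maxGain_mono (Nat.le_succ _)) (Nat.cast_nonneg _)
    · intro _
      exact ih.n_le_cost (Or.inl hf)
  · intro t st _ hs hf _ ih
    have hsp := hI.s_pos _ hs
    have hgain : I.s st.stage ≤ I.maxGain st.stage := le_maxGain le_rfl
    have hj := hI.j_ge _ hs
    have hincr : ∀ a, st.info a ≤ (st.pull {I.nextArm st} (I.s st.stage) (x t st.stage)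
        (I.j st.stage)).info a := by
      intro a
      simp only [CacoState.pull]
      split_ifs <;> linarith
    refine ⟨hs.le, fun h => absurd h hs.ne, ih.card, ?_, ?_, ?_, ?_⟩
    · intro l hl a ha
      exact (ih.info_ge l hl a ha).trans (hincr a)
    · exact fun a => (ih.info_nonneg a).trans (hincr a)
    · intro _
      obtain ⟨e, N, h1, h2, h3, h4⟩ := ih.count hs
      simp only [hf] at h1 h2
      refine ⟨e + 1, N + 1, ?_, ?_, ?_, ?_⟩
      · simp only [CacoState.pull, hf]; simp at h1 ⊢; omega
      · simp only [CacoState.pull, hf]; simp at h2 ⊢; omega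
      · simp only [CacoState.pull]; push_cast; linarith
      · intro a
        have h5 := h4 a
        have hg := maxGain_pos hI st.stage
        simp only [CacoState.pull]
        push_cast
        split_ifs <;> nlinarith
    · intro _
      have := ih.n_le_cost (Or.inl hf)
      simp only [CacoState.pull]
      linarith

/-- The state is one at which the stopping rule is checked. -/
def IsCheck (I : CacoInput n) (st : CacoState n) : Prop := st.stage < I.m ∧ st.fresh = false

/-- The number of pulls so far at a check at time `t` in stage `i`. -/
theorem RunInv.exists_pulls (hI : I.Valid) {t : ℕ} {st : CacoState n} (h : I.RunInv t st)
    (hc : I.IsCheck st) :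
    ∃ N : ℕ, t = N + 2 * st.stage + 1 - I.firstPulls (st.stage + 1) ∧ n ≤ N ∧
      (st.stage + 2) ^ 2 ≤ 2 * N ∧ (N : ℝ) ≤ st.cost ∧
      ∀ a ∈ st.active st.stage, I.maxGain st.stage ≤ st.info a ∧
        st.info a ≤ N * I.maxGain st.stage := by
  obtain ⟨e, N, h1, h2, h3, h4⟩ := h.count hc.1
  simp only [hc.2] at h1 h2
  simp at h1 h2
  have h5 := hI.n_le_firstPulls st.stage
  have h6 := hI.sq_le_firstPulls hc.1
  refine ⟨N, by omega, by omega, by omega, h3, fun a ha => ⟨maxGain_le fun l hl => ?_, h4 a⟩⟩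
  refine h.info_ge l ?_ a ha
  rcases hl.lt_or_eq with h | h
  · exact Or.inl h
  · exact Or.inr ⟨h, hc.2⟩

end CacoInput

/-! ### Cost, correctness and termination of accurate runs -/

namespace CacoInput

variable {n : ℕ} {I : CacoInput n} {u : Fin n → ℝ}

/-- The accuracy of the estimates that the analysis needs at a check: the errors of any two active
arms together are at most the sum of their radii. This is weaker than accuracy of every arm. -/
def PairAccurate (I : CacoInput n) (u : Fin n → ℝ) (st : CacoState n) : Prop :=
  ∀ a ∈ st.active st.stage, ∀ b ∈ st.active st.stage, a ≠ b →
    |st.mean a - u a| + |st.mean b - u b| ≤ I.rad st a + I.rad st b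

theorem rad_nonneg (hI : I.Valid) (st : CacoState n) (a : Fin n) : 0 ≤ I.rad st a :=
  mul_nonneg hI.σ_pos.le (Real.sqrt_nonneg _)

theorem checkData (hI : I.Valid) {st : CacoState n} (hs : st.stage < I.m)
    (hc : (st.active st.stage).card = I.K st.stage) (hp : I.PairAccurate u st) :
    CheckData (st.active st.stage) (I.K (st.stage + 1)) u st.mean (I.rad st) (I.empBest st)
      (I.pessBest st) (I.optimal u st.stage (st.active st.stage)) := by
  have hK : I.K (st.stage + 1) ≤ (st.active st.stage).card := by
    rw [hc]; exact (hI.K_lt _ hs).le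
  exact ⟨hI.oracle_max.isBestCohort _ hK, hI.oracle_max.isBestCohort (I.pess st) hK,
    hI.oracle_max.isBestCohort _ hK, rad_nonneg hI st, hp⟩

/-- An upper bound on the logarithm in the confidence radius, in terms of the cost so far. -/
noncomputable def logCost (I : CacoInput n) (c : ℝ) : ℝ := Real.log (4 * n * c ^ 3 / I.δ)

theorem logCost_nonneg (hI : I.Valid) {c : ℝ} (hc : 1 ≤ c) : 0 ≤ I.logCost c := by
  have hn : (2 : ℝ) ≤ n := by exact_mod_cast hI.two_le_n
  have h3 : 1 ≤ c ^ 3 := one_le_pow₀ hc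
  refine Real.log_nonneg ?_
  rw [le_div_iff₀ hI.δ_mem.1]
  nlinarith [hI.δ_mem.2]

theorem logCost_mono (hI : I.Valid) {c d : ℝ} (hc : 0 ≤ c) (hcd : c ≤ d) (hd : 1 ≤ d) :
    I.logCost c ≤ I.logCost d := by
  rcases hc.eq_or_lt with rfl | hc
  · refine le_trans (le_of_eq ?_) (logCost_nonneg hI hd)
    simp [logCost]
  · have hn : (2 : ℝ) ≤ n := by exact_mod_cast hI.two_le_n
    have hδ := hI.δ_mem.1
    unfold logCost
    gcongr

/-- A pulled arm had little information before the pull, relative to its hardness. -/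
theorem info_nextArm_le (hI : I.Valid) {st : CacoState n} (hs : st.stage < I.m)
    (hc : (st.active st.stage).card = I.K st.stage) (hp : I.PairAccurate u st)
    (hcost : 1 ≤ st.cost) (hinfo : ∀ a ∈ st.active st.stage, 0 < st.info a)
    (hclose : ¬ I.closeEnough st) :
    I.nextArm st ∈ st.active st.stage ∧ st.info (I.nextArm st) ≤
      128 * I.σ ^ 2 * I.armHardness u st.stage (st.active st.stage) (I.nextArm st) *
        I.logCost st.cost := by
  have hcd := checkData hI hs hc hp
  have hM := mem_powersetCard.mp hcd.best.1
  have hM' := mem_powersetCard.mp hcd.best'.1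
  set D := (I.pessBest st \ I.empBest st) ∪ (I.empBest st \ I.pessBest st) with hD
  have hne : D.Nonempty := by
    rw [nonempty_iff_ne_empty]
    intro h0
    rw [hD, union_eq_empty, sdiff_eq_empty_iff_subset, sdiff_eq_empty_iff_subset] at h0
    have heq : I.pessBest st = I.empBest st := h0.1.antisymm h0.2
    refine hclose ?_
    unfold closeEnough
    rw [heq, sub_self, abs_zero]
    exact hI.ε_mem.1
  have hpD : I.nextArm st ∈ D := hI.pick_max.mem _ _ hne
  have hmax : ∀ b ∈ D, I.rad st b ≤ I.rad st (I.nextArm st) := hI.pick_max.le _ _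
  set p := I.nextArm st with hpdef
  have hpA : p ∈ st.active st.stage := by
    rcases mem_union.mp hpD with h | h
    · exact hM'.1 (mem_sdiff.mp h).1
    · exact hM.1 (mem_sdiff.mp h).1
  refine ⟨hpA, ?_⟩
  have hε := hcd.eps_le hclose hmax
  have hK : I.K (st.stage + 1) < (st.active st.stage).card := by
    rw [hc]; exact hI.K_lt _ hs
  have hgap : I.gap u st.stage (st.active st.stage) p ≤ 8 * I.rad st p := by
    obtain ⟨h1, h2⟩ := hcd.exists_exchange hpD hmax
    by_cases hpo : p ∈ I.optimal u st.stage (st.active st.stage)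
    · obtain ⟨q, hqA, hqo, hq⟩ := h1 hpo
      exact (gap_le_of_mem hI.oracle_max hK.le hpo hqA hqo).trans hq
    · obtain ⟨q, hqo, hq⟩ := h2 hpo
      exact (gap_le_of_notMem hI.oracle_max hK.le hpo hpA hqo).trans hq
  have hone := one_le_armHardness_mul_sq hI.ε_mem.1
    (gap_nonneg hI.oracle_max hK (hI.one_le_K hs) hpA) hgap hε
  have hn : (2 : ℝ) ≤ I.K st.stage := by exact_mod_cast hI.two_le_K hs
  have hδ := hI.δ_mem
  set ℓ := Real.log (4 * (I.K st.stage : ℝ) * st.cost ^ 3 / I.δ) with hℓ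
  have h3 : 1 ≤ st.cost ^ 3 := one_le_pow₀ hcost
  have hℓ0 : 0 ≤ ℓ := by
    refine Real.log_nonneg ?_
    rw [le_div_iff₀ hδ.1]
    nlinarith [hδ.2]
  have hℓ1 : ℓ ≤ I.logCost st.cost := by
    have hKn : (I.K st.stage : ℝ) ≤ n := by exact_mod_cast hI.K_le_n hs.le
    have hδ := hI.δ_mem.1
    unfold logCost
    rw [hℓ]
    gcongr
  have hV := hinfo p hpA
  have hsq : I.rad st p ^ 2 = I.σ ^ 2 * (2 * ℓ / st.info p) := by
    unfold rad
    rw [mul_pow, Real.sq_sqrt (by positivity)]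
  rw [hsq] at hone
  have hh := armHardness_nonneg (I := I) (u := u) (i := st.stage) (A := st.active st.stage) p
  set h := I.armHardness u st.stage (st.active st.stage) p
  have e : 64 * h * (I.σ ^ 2 * (2 * ℓ / st.info p)) = 128 * I.σ ^ 2 * h * ℓ / st.info p := by ring
  rw [e, le_div_iff₀ hV, one_mul] at hone
  exact hone.trans (mul_le_mul_of_nonneg_left hℓ1 (by positivity))

/-- The bound on the cost of the completed stage `l`, when the total cost is `c`. -/
noncomputable def stageBound (I : CacoInput n) (u : Fin n → ℝ) (act : ℕ → Finset (Fin n)) (c : ℝ)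
    (l : ℕ) : ℝ :=
  I.K l * I.j l + 128 * (I.σ ^ 2 * I.j l / I.s l * I.stageHardness u l (act l)) * I.logCost c

/-- Cost accounting along an accurate run. In the current stage, `p a` is the number of pulls of
arm `a` beyond the initial one. -/
structure CostInv (I : CacoInput n) (u : Fin n → ℝ) (st : CacoState n) : Prop where
  cost_le : ∃ p : Fin n → ℝ,
    st.cost ≤ ∑ l ∈ range st.stage, I.stageBound u st.active st.cost l +
      (if st.fresh then 0 else I.K st.stage * I.j st.stage +
        I.j st.stage * ∑ a ∈ st.active st.stage, p a) ∧
    (st.fresh = false → ∀ a ∈ st.active st.stage, I.s st.stage * (p a + 1) ≤ st.info a ∧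
      I.s st.stage * p a ≤ 128 * I.σ ^ 2 *
        I.armHardness u st.stage (st.active st.stage) a * I.logCost st.cost)
  correct : ∀ i, st.stage = i + 1 → |cohortValue u (st.active (i + 1)) -
    cohortValue u (I.optimal u i (st.active i))| < I.ε

theorem stageBound_mono (hI : I.Valid) {act : ℕ → Finset (Fin n)} {c d : ℝ} (hc : 0 ≤ c)
    (hcd : c ≤ d) (hd : 1 ≤ d) {l : ℕ} (hl : l < I.m) :
    I.stageBound u act c l ≤ I.stageBound u act d l := by
  have h1 := logCost_mono hI hc hcd hd
  have h2 := stageHardness_nonneg (I := I) (u := u) (i := l) (A := act l)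
  have h3 := hI.s_pos l hl
  have h4 := zero_le_one.trans (hI.j_ge l hl)
  unfold stageBound
  gcongr

theorem stageBound_ge (hI : I.Valid) {act : ℕ → Finset (Fin n)} {c : ℝ} {l : ℕ}
    (hl : l < I.m) {p : Fin n → ℝ}
    (hp : ∀ a ∈ act l, I.s l * p a ≤ 128 * I.σ ^ 2 * I.armHardness u l (act l) a * I.logCost c) :
    I.K l * I.j l + I.j l * ∑ a ∈ act l, p a ≤ I.stageBound u act c l := by
  have h3 := hI.s_pos l hl
  have h4 := zero_le_one.trans (hI.j_ge l hl)
  unfold stageBound stageHardness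
  have e : 128 * (I.σ ^ 2 * I.j l / I.s l * ∑ a ∈ act l, I.armHardness u l (act l) a) *
      I.logCost c = I.j l * ∑ a ∈ act l,
        128 * I.σ ^ 2 * I.armHardness u l (act l) a * I.logCost c / I.s l := by
    rw [mul_sum, mul_sum, mul_sum, sum_mul]
    refine sum_congr rfl fun a _ => ?_
    ring
  rw [e]
  gcongr with a ha
  rw [le_div_iff₀ h3, mul_comm]
  exact hp a ha

theorem stageBound_congr {act act' : ℕ → Finset (Fin n)} {c : ℝ} {l : ℕ} (h : act l = act' l) :
    I.stageBound u act c l = I.stageBound u act' c l := by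
  simp [stageBound, h]

theorem stageBound_nonneg (hI : I.Valid) {act : ℕ → Finset (Fin n)} {c : ℝ} (hc : 1 ≤ c) {l : ℕ}
    (hl : l < I.m) : 0 ≤ I.stageBound u act c l := by
  have h1 := logCost_nonneg hI hc
  have h2 := stageHardness_nonneg (I := I) (u := u) (i := l) (A := act l)
  have h3 := hI.s_pos l hl
  have h4 := zero_le_one.trans (hI.j_ge l hl)
  unfold stageBound
  positivity

theorem costInv (hI : I.Valid) (x : ℕ → ℕ → Fin n → ℝ)
    (hx : ∀ t, I.IsCheck (I.run x t) → I.PairAccurate u (I.run x t)) (t : ℕ) :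
    I.CostInv u (I.run x t) := by
  refine run_induction x (p := fun _ st => I.CostInv u st) ?_ ?_ ?_ ?_ ?_ t
  · exact ⟨⟨0, by simp [start], by simp [start]⟩, by simp [start]⟩
  · intro t _ ih
    exact ih
  · intro t st hst hs hf ih
    have hinv := hst ▸ runInv hI x t
    obtain ⟨e, N, -, -, hN, -⟩ := hinv.count hs
    have hc0 : 0 ≤ st.cost := (Nat.cast_nonneg N).trans hN
    have hK : (2 : ℝ) ≤ I.K st.stage := by exact_mod_cast hI.two_le_K hs
    have hj := hI.j_ge _ hs
    have hc1 : 1 ≤ st.cost + I.K st.stage * I.j st.stage := by nlinarith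
    have hc2 : st.cost ≤ st.cost + I.K st.stage * I.j st.stage := by nlinarith
    refine ⟨⟨0, ?_, ?_⟩, ih.correct⟩
    · obtain ⟨p, hp, -⟩ := ih.cost_le
      simp only [hf, if_true, add_zero] at hp
      simp only [CacoState.pull, Bool.false_eq_true, if_false, Pi.zero_apply, sum_const_zero,
        mul_zero, add_zero]
      refine add_le_add (hp.trans (sum_le_sum fun l hl => ?_)) le_rfl
      exact stageBound_mono hI hc0 hc2 hc1 ((mem_range.mp hl).trans hs)
    · intro _ a ha
      have h1 := hinv.info_nonneg a
      have h2 := armHardness_nonneg (I := I) (u := u) (i := st.stage)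
        (A := st.active st.stage) a
      have h3 := logCost_nonneg hI hc1
      simp only [CacoState.pull] at ha ⊢
      rw [if_pos ha]
      simp only [Pi.zero_apply, zero_add, mul_one, mul_zero]
      exact ⟨by linarith, by positivity⟩
  · intro t st hst hs hf hclose ih
    have hinv := hst ▸ runInv hI x t
    have hpair := hst ▸ hx t ⟨hst ▸ hs, hst ▸ hf⟩
    have hcd := checkData hI hs (hinv.card _ le_rfl) hpair
    have hc1 : 1 ≤ st.cost := by
      have h2 : (2 : ℝ) ≤ n := by exact_mod_cast hI.two_le_n
      linarith [hinv.n_le_cost (Or.inl hf)]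
    refine ⟨⟨0, ?_, by simp⟩, ?_⟩
    · obtain ⟨p, hp, hp2⟩ := ih.cost_le
      simp only [hf, Bool.false_eq_true, if_false] at hp
      simp only [if_true, add_zero]
      rw [sum_range_succ]
      refine hp.trans (add_le_add (sum_le_sum fun l hl => le_of_eq ?_) ?_)
      · refine stageBound_congr ?_
        rw [Function.update_of_ne (by have := mem_range.mp hl; omega)]
      · have := stageBound_ge hI hs (act := st.active) (u := u) (p := p)
          (fun a ha => (hp2 hf a ha).2)
        rwa [stageBound_congr (act' := Function.update st.active (st.stage + 1) (I.empBest st))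
          (by rw [Function.update_of_ne (by omega)])] at this
    · intro i hi
      simp only [add_left_inj] at hi
      subst hi
      simp only [Function.update_self]
      rw [Function.update_of_ne (by omega)]
      exact hcd.sub_lt hclose
  · intro t st hst hs hf hclose ih
    have hinv := hst ▸ runInv hI x t
    have hpair := hst ▸ hx t ⟨hst ▸ hs, hst ▸ hf⟩
    have hc1 : 1 ≤ st.cost := by
      have h2 : (2 : ℝ) ≤ n := by exact_mod_cast hI.two_le_n
      linarith [hinv.n_le_cost (Or.inl hf)]
    have hj := hI.j_ge _ hs
    have hsp := hI.s_pos _ hs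
    have hc2 : st.cost ≤ st.cost + I.j st.stage := by linarith
    obtain ⟨hA, hinfo⟩ := info_nextArm_le hI hs (hinv.card _ le_rfl) hpair hc1
      (fun a ha => hsp.trans_le (hinv.info_ge _ (Or.inr ⟨rfl, hf⟩) a ha)) hclose
    have hmono := logCost_mono hI (by linarith) hc2 (hc1.trans hc2)
    refine ⟨?_, ih.correct⟩
    obtain ⟨p, hp, hp2⟩ := ih.cost_le
    refine ⟨fun a => p a + if a = I.nextArm st then 1 else 0, ?_, ?_⟩
    · simp only [hf, Bool.false_eq_true, if_false] at hp
      simp only [CacoState.pull, hf, Bool.false_eq_true, if_false]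
      rw [sum_add_distrib, sum_ite_eq' _ _ (fun _ => (1 : ℝ)), if_pos hA, mul_add, mul_one]
      have : ∑ l ∈ range st.stage, I.stageBound u st.active st.cost l ≤
          ∑ l ∈ range st.stage, I.stageBound u st.active (st.cost + I.j st.stage) l :=
        sum_le_sum fun l hl => stageBound_mono hI (by linarith) hc2 (hc1.trans hc2)
          ((mem_range.mp hl).trans hs)
      linarith
    · intro _ a ha
      simp only [CacoState.pull] at ha ⊢
      obtain ⟨h1, h2⟩ := hp2 hf a ha
      have h3 := armHardness_nonneg (I := I) (u := u) (i := st.stage)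
        (A := st.active st.stage) a
      have h4 : 128 * I.σ ^ 2 * I.armHardness u st.stage (st.active st.stage) a *
          I.logCost st.cost ≤ 128 * I.σ ^ 2 *
          I.armHardness u st.stage (st.active st.stage) a * I.logCost (st.cost + I.j st.stage) :=
        mul_le_mul_of_nonneg_left hmono (by positivity)
      by_cases hap : a = I.nextArm st
      · subst hap
        simp only [mem_singleton, if_true]
        refine ⟨by linarith, ?_⟩
        linarith
      · simp only [mem_singleton, hap, if_false, add_zero]
        exact ⟨h1, h2.trans h4⟩

/-- A bound on the cost by the logarithm of the cost, uniform over all possible active sets. -/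
theorem cost_le_of_running (hI : I.Valid) {st : CacoState n} (h : I.CostInv u st)
    (hs : st.stage < I.m) (hc : 1 ≤ st.cost) :
    st.cost ≤ ∑ l ∈ range I.m, I.K l * I.j l + (∑ l ∈ range I.m, 128 * (I.σ ^ 2 * I.j l / I.s l *
      (n * ((I.K (l + 1) : ℝ) ^ 2 / I.ε ^ 2)))) * I.logCost st.cost := by
  have hlog := logCost_nonneg hI hc
  obtain ⟨p, hp, hp2⟩ := h.cost_le
  have h1 : st.cost ≤ ∑ l ∈ range (st.stage + 1), I.stageBound u st.active st.cost l := by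
    rw [sum_range_succ]
    refine hp.trans (add_le_add le_rfl ?_)
    split_ifs with hf
    · exact stageBound_nonneg hI hc hs
    · exact stageBound_ge hI hs fun a ha => (hp2 (by simpa using hf) a ha).2
  refine h1.trans ?_
  refine (sum_le_sum_of_subset_of_nonneg (range_mono hs) fun l hl _ =>
    stageBound_nonneg hI hc (mem_range.mp hl)).trans ?_
  rw [sum_mul, ← sum_add_distrib]
  refine sum_le_sum fun l hl => ?_
  have h3 := hI.s_pos l (mem_range.mp hl)
  have h4 := zero_le_one.trans (hI.j_ge l (mem_range.mp hl))
  have h5 := stageHardness_le (I := I) (u := u) (i := l) (A := st.active l)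
  unfold stageBound
  gcongr

theorem logCost_eventually_lt (hI : I.Valid) (α β : ℝ) :
    ∃ x₀ : ℝ, ∀ c, x₀ ≤ c → α + β * I.logCost c < c := by
  have hδ := hI.δ_mem.1
  have hn : (0 : ℝ) < n := by
    have : (2 : ℝ) ≤ n := by exact_mod_cast hI.two_le_n
    linarith
  have hq : 0 < 4 * (n : ℝ) / I.δ := by positivity
  have h1 : (fun c : ℝ => α + β * (Real.log (4 * n / I.δ) + 3 * Real.log c)) =o[Filter.atTop]
      (id : ℝ → ℝ) := by
    refine Asymptotics.IsLittleO.add ?_ (Asymptotics.IsLittleO.const_mul_left ?_ _)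
    · exact Asymptotics.isLittleO_const_id_atTop _
    · exact (Asymptotics.isLittleO_const_id_atTop _).add
        (Real.isLittleO_log_id_atTop.const_mul_left _)
  have h2 := (h1.def (c := 1 / 2) (by norm_num)).and (Filter.eventually_ge_atTop (1 : ℝ))
  obtain ⟨x₀, hx⟩ := Filter.eventually_atTop.mp h2
  refine ⟨x₀, fun c hc => ?_⟩
  obtain ⟨h3, h4⟩ := hx c hc
  have e : I.logCost c = Real.log (4 * n / I.δ) + 3 * Real.log c := by
    unfold logCost
    rw [show 4 * (n : ℝ) * c ^ 3 / I.δ = (4 * n / I.δ) * c ^ 3 by ring,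
      Real.log_mul hq.ne' (by positivity), Real.log_pow]
    norm_num
  rw [e]
  have h5 := (le_abs_self _).trans h3
  rw [id, Real.norm_of_nonneg (by linarith)] at h5
  linarith

/-- An accurate run halts: its cost grows linearly in time, and is bounded by its logarithm. -/
theorem exists_halted (hI : I.Valid) (x : ℕ → ℕ → Fin n → ℝ)
    (hx : ∀ t, I.IsCheck (I.run x t) → I.PairAccurate u (I.run x t)) :
    ∃ t, (I.run x t).stage = I.m := by
  by_contra! hne
  have hs : ∀ t, (I.run x t).stage < I.m := fun t =>
    lt_of_le_of_ne (runInv hI x t).stage_le (hne t)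
  obtain ⟨x₀, hx₀⟩ := logCost_eventually_lt hI (∑ l ∈ range I.m, I.K l * I.j l)
    (∑ l ∈ range I.m, 128 * (I.σ ^ 2 * I.j l / I.s l *
      (n * ((I.K (l + 1) : ℝ) ^ 2 / I.ε ^ 2))))
  obtain ⟨k, hk⟩ := exists_nat_ge x₀
  set t := 2 * I.m + 2 + k with ht
  obtain ⟨e, N, h1, h2, h3, -⟩ := (runInv hI x t).count (hs t)
  have hb : (if (I.run x t).fresh then 0 else 1) ≤ 1 := by split_ifs <;> omega
  have hN : k + 1 ≤ N := by
    have := hs t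
    omega
  have hN' : (k : ℝ) + 1 ≤ N := by exact_mod_cast hN
  have hk0 : (0 : ℝ) ≤ k := Nat.cast_nonneg k
  have h4 := cost_le_of_running hI (costInv hI x hx t) (hs t) (by linarith)
  exact absurd h4 (not_le.mpr (hx₀ _ (by linarith)))

theorem halted_spec (hI : I.Valid) (x : ℕ → ℕ → Fin n → ℝ)
    (hx : ∀ t, I.IsCheck (I.run x t) → I.PairAccurate u (I.run x t)) {t : ℕ}
    (ht : (I.run x t).stage = I.m) :
    |cohortValue u ((I.run x t).active I.m) -
      cohortValue u (I.optimal u (I.m - 1) ((I.run x t).active (I.m - 1)))| < I.ε ∧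
    (n : ℝ) ≤ (I.run x t).cost ∧
    (I.run x t).cost ≤ ∑ l ∈ range I.m,
      I.stageBound u (I.run x t).active (I.run x t).cost l := by
  have hinv := runInv hI x t
  have hci := costInv hI x hx t
  have hm := hI.m_pos
  refine ⟨?_, hinv.n_le_cost (Or.inr (by omega)), ?_⟩
  · have := hci.correct (I.m - 1) (by omega)
    rwa [Nat.sub_add_cancel hm] at this
  · obtain ⟨p, hp, -⟩ := hci.cost_le
    rw [hinv.fresh_of_halted ht, ht] at hp
    simpa using hp

end CacoInput

/-! ### Measurability of the run -/

/-- A countably valued function all of whose fibers are measurable. -/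
def CodeMeasurable {Ω κ : Type*} (mΩ : MeasurableSpace Ω) (k : Ω → κ) : Prop :=
  ∀ c, MeasurableSet[mΩ] {ω | k ω = c}

namespace CodeMeasurable

theorem const {Ω κ : Type*} {mΩ : MeasurableSpace Ω} (c : κ) : CodeMeasurable mΩ fun _ : Ω => c :=
  fun _ => MeasurableSet.const _

variable {Ω κ κ' β : Type*} {mΩ : MeasurableSpace Ω} [Countable κ] {k : Ω → κ}

theorem measurableSet (hk : CodeMeasurable mΩ k) {p : κ → Ω → Prop}
    (hp : ∀ c, MeasurableSet {ω | p c ω}) : MeasurableSet {ω | p (k ω) ω} := by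
  have : {ω | p (k ω) ω} = ⋃ c, {ω | k ω = c} ∩ {ω | p c ω} := by
    ext ω
    simp
  rw [this]
  exact MeasurableSet.iUnion fun c => (hk c).inter (hp c)

theorem measurable [MeasurableSpace β] (hk : CodeMeasurable mΩ k) {g : κ → Ω → β}
    (hg : ∀ c, Measurable (g c)) : Measurable fun ω => g (k ω) ω :=
  fun _ hs => hk.measurableSet (p := fun c ω => g c ω ∈ _) fun c => hg c hs

theorem bind (hk : CodeMeasurable mΩ k) {g : κ → Ω → κ'} (hg : ∀ c, CodeMeasurable mΩ (g c)) :
    CodeMeasurable mΩ fun ω => g (k ω) ω :=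
  fun d => hk.measurableSet (p := fun c ω => g c ω = d) fun c => hg c d

theorem map (hk : CodeMeasurable mΩ k) (g : κ → κ') : CodeMeasurable mΩ fun ω => g (k ω) :=
  hk.bind fun _ => const _

theorem prodMk [Countable κ'] (hk : CodeMeasurable mΩ k) {k' : Ω → κ'}
    (hk' : CodeMeasurable mΩ k') :
    CodeMeasurable mΩ fun ω => (k ω, k' ω) :=
  hk.bind (g := fun c ω => (c, k' ω)) fun c => hk'.map fun c' => (c, c')

end CodeMeasurable

/-- Measurability of a random state of the algorithm, field by field. -/
structure StateMeasurable {Ω : Type*} {n : ℕ} (mΩ : MeasurableSpace Ω) (st : Ω → CacoState n) :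
    Prop where
  stage : CodeMeasurable mΩ fun ω => (st ω).stage
  fresh : CodeMeasurable mΩ fun ω => (st ω).fresh
  active : ∀ i, CodeMeasurable mΩ fun ω => (st ω).active i
  info : ∀ a, Measurable fun ω => (st ω).info a
  wsum : ∀ a, Measurable fun ω => (st ω).wsum a
  cost : Measurable fun ω => (st ω).cost

/-- The data that determine what the next step does, apart from the rewards: the stage, whether it
is fresh, its active arms, the empirically best cohort, whether the stopping rule holds, and the
next arm. -/
abbrev StepCode (n : ℕ) : Type := ℕ × Bool × Finset (Fin n) × Finset (Fin n) × Prop × Fin n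

namespace CacoInput

variable {n : ℕ} {I : CacoInput n} {Ω : Type*} {mΩ : MeasurableSpace Ω}

/-- The `StepCode` of a state. -/
noncomputable def stepCode (I : CacoInput n) (st : CacoState n) : StepCode n :=
  (st.stage, st.fresh, st.active st.stage, I.empBest st, I.closeEnough st, I.nextArm st)

open Classical in
/-- The step prescribed by a given `StepCode`. -/
noncomputable def stepBy (I : CacoInput n) (c : StepCode n) (x : ℕ → Fin n → ℝ)
    (st : CacoState n) : CacoState n :=
  if I.m ≤ c.1 then st
  else if c.2.1 = true then
    { st.pull c.2.2.1 (I.s c.1) (x c.1) ((I.K c.1 : ℝ) * I.j c.1) with fresh := false }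
  else if c.2.2.2.2.1 then
    { st with
      stage := c.1 + 1
      fresh := true
      active := Function.update st.active (c.1 + 1) c.2.2.2.1 }
  else
    st.pull {c.2.2.2.2.2} (I.s c.1) (x c.1) (I.j c.1)

open Classical in
/-- The arms that are pulled in the step prescribed by a given `StepCode`. -/
noncomputable def pulled (I : CacoInput n) (c : StepCode n) : Finset (Fin n) :=
  if I.m ≤ c.1 then ∅
  else if c.2.1 = true then c.2.2.1
  else if c.2.2.2.2.1 then ∅
  else {c.2.2.2.2.2}

theorem lt_of_mem_pulled {c : StepCode n} {a : Fin n} (h : a ∈ I.pulled c) : c.1 < I.m := by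
  by_contra hc
  rw [not_lt] at hc
  simp [pulled, hc] at h

theorem stepBy_info (c : StepCode n) (x : ℕ → Fin n → ℝ) (st : CacoState n) (a : Fin n) :
    (I.stepBy c x st).info a = st.info a + if a ∈ I.pulled c then I.s c.1 else 0 := by
  unfold stepBy pulled
  split_ifs <;> simp_all [CacoState.pull]

theorem stepBy_wsum (c : StepCode n) (x : ℕ → Fin n → ℝ) (st : CacoState n) (a : Fin n) :
    (I.stepBy c x st).wsum a =
      st.wsum a + if a ∈ I.pulled c then I.s c.1 * x c.1 a else 0 := by
  unfold stepBy pulled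
  split_ifs <;> simp_all [CacoState.pull]

end CacoInput

namespace StateMeasurable

variable {n : ℕ} {I : CacoInput n} {Ω : Type*} {mΩ : MeasurableSpace Ω} {st : Ω → CacoState n}

theorem bind {κ : Type*} [Countable κ] {k : Ω → κ} (hk : CodeMeasurable mΩ k)
    {g : κ → Ω → CacoState n} (hg : ∀ c, StateMeasurable mΩ (g c)) :
    StateMeasurable mΩ fun ω => g (k ω) ω where
  stage := hk.bind (g := fun c ω => (g c ω).stage) fun c => (hg c).stage
  fresh := hk.bind (g := fun c ω => (g c ω).fresh) fun c => (hg c).fresh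
  active i := hk.bind (g := fun c ω => (g c ω).active i) fun c => (hg c).active i
  info a := hk.measurable (g := fun c ω => (g c ω).info a) fun c => (hg c).info a
  wsum a := hk.measurable (g := fun c ω => (g c ω).wsum a) fun c => (hg c).wsum a
  cost := hk.measurable (g := fun c ω => (g c ω).cost) fun c => (hg c).cost

theorem currentActive (h : StateMeasurable mΩ st) :
    CodeMeasurable mΩ fun ω => (st ω).active (st ω).stage :=
  h.stage.bind (g := fun c ω => (st ω).active c) fun c => h.active c

theorem mean (h : StateMeasurable mΩ st) : Measurable fun ω => (st ω).mean :=
  measurable_pi_iff.mpr fun a => (h.wsum a).div (h.info a)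

theorem rad (h : StateMeasurable mΩ st) : Measurable fun ω => I.rad (st ω) := by
  refine measurable_pi_iff.mpr fun a => ?_
  refine h.stage.measurable (g := fun c ω => I.σ * √(2 * Real.log (4 * (I.K c : ℝ) *
    (st ω).cost ^ 3 / I.δ) / (st ω).info a)) fun c => ?_
  have h1 := h.cost
  have h2 := h.info a
  fun_prop

theorem oracle (hI : IsMaxOracle I.oracle) (h : StateMeasurable mΩ st) {v : Ω → Fin n → ℝ}
    (hv : Measurable v) :
    CodeMeasurable mΩ fun ω =>
      I.oracle (I.K ((st ω).stage + 1)) (v ω) ((st ω).active (st ω).stage) :=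
  (h.stage.prodMk h.currentActive).bind (g := fun c ω => I.oracle (I.K (c.1 + 1)) (v ω) c.2)
    fun c M => hv (hI.measurable (I.K (c.1 + 1)) c.2 M)

theorem empBest (hI : IsMaxOracle I.oracle) (h : StateMeasurable mΩ st) :
    CodeMeasurable mΩ fun ω => I.empBest (st ω) :=
  h.oracle hI h.mean

theorem pess (hI : IsMaxOracle I.oracle) (h : StateMeasurable mΩ st) :
    Measurable fun ω => I.pess (st ω) := by
  refine measurable_pi_iff.mpr fun a => ?_
  have h1 := measurable_pi_iff.mp h.mean a
  have h2 := measurable_pi_iff.mp (h.rad (I := I)) a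
  refine (h.empBest hI).measurable (g := fun M ω => if a ∈ M then (st ω).mean a - I.rad (st ω) a
    else (st ω).mean a + I.rad (st ω) a) fun M => ?_
  split_ifs
  · exact h1.sub h2
  · exact h1.add h2

theorem pessBest (hI : IsMaxOracle I.oracle) (h : StateMeasurable mΩ st) :
    CodeMeasurable mΩ fun ω => I.pessBest (st ω) :=
  h.oracle hI (h.pess hI)

theorem measurable_cohortValue {v : Ω → Fin n → ℝ} (hv : Measurable v) (M : Finset (Fin n)) :
    Measurable fun ω => cohortValue (v ω) M :=
  Finset.measurable_sum M fun a _ => measurable_pi_iff.mp hv a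

theorem closeEnough (hI : IsMaxOracle I.oracle) (h : StateMeasurable mΩ st) :
    MeasurableSet {ω | I.closeEnough (st ω)} := by
  refine ((h.pessBest hI).prodMk (h.empBest hI)).measurableSet
    (p := fun c ω => |cohortValue (I.pess (st ω)) c.1 - cohortValue (I.pess (st ω)) c.2| < I.ε)
    fun c => ?_
  have h1 := measurable_cohortValue (h.pess hI) c.1
  have h2 := measurable_cohortValue (h.pess hI) c.2
  exact measurableSet_lt (continuous_abs.measurable.comp (h1.sub h2)) measurable_const

theorem nextArm (hI : IsMaxOracle I.oracle) (hp : IsArgmaxRule I.pick)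
    (h : StateMeasurable mΩ st) : CodeMeasurable mΩ fun ω => I.nextArm (st ω) :=
  ((h.pessBest hI).prodMk (h.empBest hI)).bind
    (g := fun c ω => I.pick (I.rad (st ω)) ((c.1 \ c.2) ∪ (c.2 \ c.1)))
    fun c a => h.rad (hp.measurable ((c.1 \ c.2) ∪ (c.2 \ c.1)) a)

theorem stepCode (hI : I.Valid) (h : StateMeasurable mΩ st) :
    CodeMeasurable mΩ fun ω => I.stepCode (st ω) := by
  have hclose : CodeMeasurable mΩ fun ω => I.closeEnough (st ω) := by
    intro q
    have hm := h.closeEnough hI.oracle_max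
    by_cases hq : q
    · have e : {ω | I.closeEnough (st ω) = q} = {ω | I.closeEnough (st ω)} := by simp [hq]
      rwa [e]
    · have e : {ω | I.closeEnough (st ω) = q} = {ω | I.closeEnough (st ω)}ᶜ := by ext; simp [hq]
      rw [e]
      exact hm.compl
  exact h.stage.prodMk (h.fresh.prodMk (h.currentActive.prodMk
    ((h.empBest hI.oracle_max).prodMk (hclose.prodMk (h.nextArm hI.oracle_max hI.pick_max)))))

theorem stepBy (h : StateMeasurable mΩ st) {x : Ω → ℕ → Fin n → ℝ}
    (hx : ∀ i < I.m, ∀ a, Measurable fun ω => x ω i a) (c : StepCode n) :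
    StateMeasurable mΩ fun ω => I.stepBy c (x ω) (st ω) where
  stage := by
    unfold CacoInput.stepBy
    split_ifs
    exacts [h.stage, h.stage, CodeMeasurable.const _, h.stage]
  fresh := by
    unfold CacoInput.stepBy
    split_ifs
    exacts [h.fresh, CodeMeasurable.const _, CodeMeasurable.const _, h.fresh]
  active i := by
    unfold CacoInput.stepBy
    split_ifs
    · exact h.active i
    · exact h.active i
    · by_cases hi : i = c.1 + 1
      · subst hi
        simpa only [Function.update_self] using CodeMeasurable.const _
      · simpa only [Function.update_of_ne hi] using h.active i
    · exact h.active i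
  info a := by
    simp_rw [CacoInput.stepBy_info]
    exact (h.info a).add_const _
  wsum a := by
    simp_rw [CacoInput.stepBy_wsum]
    by_cases ha : a ∈ I.pulled c
    · simp only [ha, if_true]
      exact (h.wsum a).add ((hx _ (CacoInput.lt_of_mem_pulled ha) a).const_mul _)
    · simpa only [ha, if_false, add_zero] using h.wsum a
  cost := by
    unfold CacoInput.stepBy
    split_ifs
    exacts [h.cost, h.cost.add_const _, h.cost, h.cost.add_const _]

/-- The state at time `t` is measurable with respect to every `σ`-algebra that makes the rewards
before time `t` measurable. -/
theorem run (hI : I.Valid) {x : Ω → ℕ → ℕ → Fin n → ℝ} (t : ℕ)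
    (hx : ∀ t' < t, ∀ i < I.m, ∀ a, Measurable fun ω => x ω t' i a) :
    StateMeasurable mΩ fun ω => I.run (x ω) t := by
  induction t with
  | zero =>
    exact ⟨CodeMeasurable.const _, CodeMeasurable.const _, fun _ => CodeMeasurable.const _,
      fun _ => measurable_const, fun _ => measurable_const, measurable_const⟩
  | succ t ih =>
    have h := ih fun t' ht' => hx t' (by omega)
    exact StateMeasurable.bind (h.stepCode hI)
      (g := fun c ω => I.stepBy c (x ω t) (I.run (x ω) t))
      fun c => h.stepBy (hx t (by omega)) c

end StateMeasurable

/-! ### The exponential supermartingale -/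

/-- The `σ`-algebra generated by the variables `Y q` with `q ∈ S`. -/
@[reducible] def sigmaOf {Ω ι : Type*} (Y : ι → Ω → ℝ) (S : Finset ι) : MeasurableSpace Ω :=
  MeasurableSpace.comap (fun ω (q : S) => Y q ω) inferInstance

theorem measurable_sigmaOf {Ω ι : Type*} (Y : ι → Ω → ℝ) {S : Finset ι} {q : ι} (hq : q ∈ S) :
    Measurable[sigmaOf Y S] (Y q) :=
  (measurable_pi_apply (⟨q, hq⟩ : S)).comp (comap_measurable (fun ω (q : S) => Y q ω))

theorem sigmaOf_le {Ω ι : Type*} {mΩ : MeasurableSpace Ω} {Y : ι → Ω → ℝ}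
    (hY : ∀ q, Measurable (Y q)) (S : Finset ι) : sigmaOf Y S ≤ mΩ :=
  (measurable_pi_lambda _ fun q : S => hY q).comap_le

/-- Multiplying by a factor that is chosen by the past among countably many factors, each
independent of the past and of expectation at most `1`, does not increase the expectation. -/
theorem lintegral_mul_code_le {Ω κ : Type*} [Countable κ] {mS mT mΩ : MeasurableSpace Ω}
    {P : Measure Ω} (hS : mS ≤ mΩ) (hT : mT ≤ mΩ) (hind : Indep mS mT P) {k : Ω → κ}
    (hk : CodeMeasurable mS k) {Z : Ω → ENNReal} (hZ : Measurable[mS] Z) {W : κ → Ω → ENNReal}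
    (hW : ∀ c, Measurable[mT] (W c)) (hle : ∀ c, ∫⁻ ω, W c ω ∂P ≤ 1) :
    ∫⁻ ω, Z ω * W (k ω) ω ∂P ≤ ∫⁻ ω, Z ω ∂P := by
  have hdisj : Pairwise (Function.onFun Disjoint fun c => {ω | k ω = c}) := by
    intro c d hcd
    rw [Function.onFun, Set.disjoint_left]
    exact fun ω h1 h2 => hcd (h1.symm.trans h2)
  have hcover : ⋃ c, {ω | k ω = c} = Set.univ := Set.eq_univ_of_forall fun ω =>
    Set.mem_iUnion.mpr ⟨k ω, rfl⟩
  have hm : ∀ c, MeasurableSet[mΩ] {ω | k ω = c} := fun c => hS _ (hk c)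
  rw [← setLIntegral_univ, ← setLIntegral_univ (μ := P) Z, ← hcover,
    lintegral_iUnion hm hdisj, lintegral_iUnion hm hdisj]
  refine ENNReal.tsum_le_tsum fun c => ?_
  rw [← lintegral_indicator (hm c), ← lintegral_indicator (hm c)]
  have e : ({ω | k ω = c}.indicator fun ω => Z ω * W (k ω) ω) =
      fun ω => {ω | k ω = c}.indicator Z ω * W c ω := by
    ext ω
    by_cases hω : k ω = c
    · rw [Set.indicator_of_mem (show ω ∈ {ω | k ω = c} from hω),
        Set.indicator_of_mem (show ω ∈ {ω | k ω = c} from hω), hω]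
    · rw [Set.indicator_of_notMem (show ω ∉ {ω | k ω = c} from hω),
        Set.indicator_of_notMem (show ω ∉ {ω | k ω = c} from hω), zero_mul]
  rw [e, lintegral_mul_eq_lintegral_mul_lintegral_of_independent_measurableSpace hS hT hind
    (hZ.indicator (hk c)) (hW c)]
  exact mul_le_of_le_one_right' (hle c)

namespace CacoInput

variable {n : ℕ} {I : CacoInput n} {u : Fin n → ℝ}

/-- The exponent of the exponential supermartingale with direction `l`: the `l`-combination of the
centered weighted reward sums, minus half of its sub-Gaussian variance proxy. -/
noncomputable def logMart (I : CacoInput n) (u l : Fin n → ℝ) (st : CacoState n) : ℝ :=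
  ∑ a, (l a * (st.wsum a - u a * st.info a) - l a ^ 2 * I.σ ^ 2 * st.info a / 2)

theorem logMart_stepBy (l : Fin n → ℝ) (c : StepCode n) (x : ℕ → Fin n → ℝ) (st : CacoState n) :
    I.logMart u l (I.stepBy c x st) = I.logMart u l st +
      (∑ a ∈ I.pulled c, l a * I.s c.1 * (x c.1 a - u a) -
        ∑ a ∈ I.pulled c, l a ^ 2 * I.σ ^ 2 * I.s c.1 / 2) := by
  unfold logMart
  rw [← sum_sub_distrib, ← sum_filter_add_sum_filter_not univ (· ∈ I.pulled c)
    (fun a => l a * ((I.stepBy c x st).wsum a - u a * (I.stepBy c x st).info a) -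
      l a ^ 2 * I.σ ^ 2 * (I.stepBy c x st).info a / 2),
    ← sum_filter_add_sum_filter_not univ (· ∈ I.pulled c)
    (fun a => l a * (st.wsum a - u a * st.info a) - l a ^ 2 * I.σ ^ 2 * st.info a / 2)]
  have e1 : univ.filter (· ∈ I.pulled c) = I.pulled c := by ext; simp
  rw [e1, add_right_comm, ← sum_add_distrib]
  congr 1
  · refine sum_congr rfl fun a ha => ?_
    rw [stepBy_info, stepBy_wsum, if_pos ha, if_pos ha]
    ring
  · refine sum_congr rfl fun a ha => ?_
    rw [mem_filter] at ha
    rw [stepBy_info, stepBy_wsum, if_neg ha.2, if_neg ha.2]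
    ring

theorem run_succ (x : ℕ → ℕ → Fin n → ℝ) (t : ℕ) :
    I.run x (t + 1) = I.stepBy (I.stepCode (I.run x t)) (x t) (I.run x t) := rfl

theorem logMart_start (l : Fin n → ℝ) : I.logMart u l (start n) = 0 := by
  simp [logMart, start]

theorem _root_.StateMeasurable.logMart {Ω : Type*} {mΩ : MeasurableSpace Ω}
    {st : Ω → CacoState n} (h : StateMeasurable mΩ st) (l : Fin n → ℝ) :
    Measurable fun ω => I.logMart u l (st ω) := by
  unfold CacoInput.logMart
  refine Finset.measurable_sum _ fun a _ => ?_
  have h1 := h.info a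
  have h2 := h.wsum a
  fun_prop

section Probability

variable {Ω : Type*} [MeasurableSpace Ω] {P : Measure Ω} [IsProbabilityMeasure P]
  {X : ℕ → ℕ → Fin n → Ω → ℝ}

/-- The factor by which the exponential supermartingale changes in a step at time `t` that is
prescribed by the code `c`. -/
noncomputable def stepFactor (I : CacoInput n) (u : Fin n → ℝ) (X : ℕ → ℕ → Fin n → Ω → ℝ)
    (l : Fin n → ℝ) (t : ℕ) (c : StepCode n) (ω : Ω) : ENNReal :=
  ENNReal.ofReal (Real.exp (∑ a ∈ I.pulled c, l a * I.s c.1 * (X t c.1 a ω - u a) -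
    ∑ a ∈ I.pulled c, l a ^ 2 * I.σ ^ 2 * I.s c.1 / 2))

theorem lintegral_stepFactor_le_one (hI : I.Valid)
    (hind : iIndepFun (fun q : ℕ × Fin I.m × Fin n => X q.1 (q.2.1 : ℕ) q.2.2) P)
    (hsub : ∀ t, ∀ i < I.m, ∀ a, HasSubgaussianMGF (fun ω => X t i a ω - u a)
      (Real.toNNReal (I.σ ^ 2 / I.s i)) P)
    (l : Fin n → ℝ) (t : ℕ) (c : StepCode n) :
    ∫⁻ ω, stepFactor I u X l t c ω ∂P ≤ 1 := by
  unfold stepFactor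
  rcases (I.pulled c).eq_empty_or_nonempty with h0 | ⟨b, hb⟩
  · simp [h0]
  have hlt := lt_of_mem_pulled hb
  have hs := hI.s_pos _ hlt
  have hind' : iIndepFun (fun a ω => l a * I.s c.1 * (X t c.1 a ω - u a)) P :=
    (hind.precomp (g := fun a : Fin n => (t, (⟨c.1, hlt⟩ : Fin I.m), a))
      (fun a b h => by simpa using h)).comp (fun a y => l a * I.s c.1 * (y - u a))
      (fun a => by fun_prop)
  have hsum := HasSubgaussianMGF.sum_of_iIndepFun hind' (s := I.pulled c)
    (fun a _ => (hsub t c.1 hlt a).const_mul (l a * I.s c.1))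
  have hmgf := hsum.mgf_le 1
  have hint := hsum.integrable_exp_mul 1
  simp only [one_mul] at hint
  simp only [mgf, one_mul] at hmgf
  simp_rw [Real.exp_sub]
  rw [← ofReal_integral_eq_lintegral_ofReal (hint.div_const _)
    (Filter.Eventually.of_forall fun ω => by positivity), integral_div, ENNReal.ofReal_le_one,
    div_le_one (Real.exp_pos _)]
  refine hmgf.trans (Real.exp_le_exp.mpr (le_of_eq ?_))
  rw [NNReal.coe_sum, one_pow, mul_one, sum_div]
  refine sum_congr rfl fun a _ => ?_
  change (l a * I.s c.1) ^ 2 * ((I.σ ^ 2 / I.s c.1).toNNReal : ℝ) / 2 = _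
  rw [Real.coe_toNNReal _ (by positivity)]
  field_simp

/-- The exponential supermartingale has expectation at most `1` at every time. -/
theorem lintegral_exp_logMart_le_one (hI : I.Valid)
    (hX : ∀ t, ∀ i < I.m, ∀ a, Measurable (X t i a))
    (hind : iIndepFun (fun q : ℕ × Fin I.m × Fin n => X q.1 (q.2.1 : ℕ) q.2.2) P)
    (hsub : ∀ t, ∀ i < I.m, ∀ a, HasSubgaussianMGF (fun ω => X t i a ω - u a)
      (Real.toNNReal (I.σ ^ 2 / I.s i)) P)
    (l : Fin n → ℝ) (t : ℕ) :
    ∫⁻ ω, ENNReal.ofReal (Real.exp (I.logMart u l (I.run (fun t i a => X t i a ω) t))) ∂P ≤ 1 := by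
  induction t with
  | zero => simp [run, logMart_start]
  | succ t ih =>
    refine le_trans ?_ ih
    set Y : ℕ × Fin I.m × Fin n → Ω → ℝ := fun q => X q.1 (q.2.1 : ℕ) q.2.2
    have hYm : ∀ q, Measurable (Y q) := fun q => hX _ _ q.2.1.2 _
    -- the indices of the rewards before time `t`, and of the rewards at time `t`
    set S : Finset (ℕ × Fin I.m × Fin n) := range t ×ˢ univ with hS
    set T : Finset (ℕ × Fin I.m × Fin n) := {t} ×ˢ univ with hT
    have hST : Disjoint S T := by
      rw [Finset.disjoint_left]
      rintro q h1 h2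
      rw [hS, mem_product, mem_range] at h1
      rw [hT, mem_product, mem_singleton] at h2
      omega
    have hindST : Indep (sigmaOf Y S) (sigmaOf Y T) P := hind.indepFun_finset S T hST hYm
    have hR : StateMeasurable (sigmaOf Y S) fun ω => I.run (fun t i a => X t i a ω) t :=
      StateMeasurable.run hI t fun t' ht' i hi a =>
        measurable_sigmaOf Y (q := (t', ⟨i, hi⟩, a)) (by simp [hS, ht'])
    have hZ : Measurable[sigmaOf Y S] fun ω =>
        ENNReal.ofReal (Real.exp (I.logMart u l (I.run (fun t i a => X t i a ω) t))) :=
      ENNReal.measurable_ofReal.comp (Real.measurable_exp.comp (hR.logMart l))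
    have hW : ∀ c, Measurable[sigmaOf Y T] (stepFactor I u X l t c) := by
      intro c
      have h1 : ∀ a ∈ I.pulled c, Measurable[sigmaOf Y T]
          fun ω => l a * I.s c.1 * (X t c.1 a ω - u a) := by
        intro a ha
        have h2 : Measurable[sigmaOf Y T] (X t c.1 a) :=
          measurable_sigmaOf Y (q := (t, ⟨c.1, lt_of_mem_pulled ha⟩, a)) (by simp [hT])
        exact (h2.sub_const _).const_mul _
      have h3 := Finset.measurable_sum (I.pulled c) h1
      exact ENNReal.measurable_ofReal.comp (Real.measurable_exp.comp (h3.sub_const _))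
    have hstep : ∀ ω, ENNReal.ofReal (Real.exp (I.logMart u l
        (I.run (fun t i a => X t i a ω) (t + 1)))) =
        ENNReal.ofReal (Real.exp (I.logMart u l (I.run (fun t i a => X t i a ω) t))) *
          stepFactor I u X l t (I.stepCode (I.run (fun t i a => X t i a ω) t)) ω := by
      intro ω
      rw [run_succ, logMart_stepBy, Real.exp_add, ENNReal.ofReal_mul (Real.exp_pos _).le,
        stepFactor]
    simp_rw [hstep]
    exact lintegral_mul_code_le (sigmaOf_le hYm S) (sigmaOf_le hYm T) hindST (hR.stepCode hI) hZ hW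
      fun c => lintegral_stepFactor_le_one hI hind hsub l t c

/-- Chernoff bound for the exponential supermartingale at a fixed time. -/
theorem measure_le_logMart (hI : I.Valid)
    (hX : ∀ t, ∀ i < I.m, ∀ a, Measurable (X t i a))
    (hind : iIndepFun (fun q : ℕ × Fin I.m × Fin n => X q.1 (q.2.1 : ℕ) q.2.2) P)
    (hsub : ∀ t, ∀ i < I.m, ∀ a, HasSubgaussianMGF (fun ω => X t i a ω - u a)
      (Real.toNNReal (I.σ ^ 2 / I.s i)) P)
    (l : Fin n → ℝ) (t : ℕ) (r : ℝ) :
    P {ω | r ≤ I.logMart u l (I.run (fun t i a => X t i a ω) t)} ≤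
      ENNReal.ofReal (Real.exp (-r)) := by
  have h1 := lintegral_exp_logMart_le_one hI hX hind hsub l t
  have hst : StateMeasurable ‹MeasurableSpace Ω› fun ω => I.run (fun t i a => X t i a ω) t :=
    StateMeasurable.run hI t fun t' _ i hi a => hX t' i hi a
  have hm := hst.logMart (I := I) (u := u) l
  have h2 := mul_meas_ge_le_lintegral (μ := P)
    (ENNReal.measurable_ofReal.comp (Real.measurable_exp.comp hm)) (ENNReal.ofReal (Real.exp r))
  have h3 : {ω | r ≤ I.logMart u l (I.run (fun t i a => X t i a ω) t)} ⊆
      {ω | ENNReal.ofReal (Real.exp r) ≤ (ENNReal.ofReal ∘ Real.exp ∘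
        fun ω => I.logMart u l (I.run (fun t i a => X t i a ω) t)) ω} := fun ω hω =>
    ENNReal.ofReal_le_ofReal (Real.exp_le_exp.mpr hω)
  have h4 := (mul_le_mul_right (measure_mono (μ := P) h3)
    (ENNReal.ofReal (Real.exp r))).trans (h2.trans h1)
  rw [Real.exp_neg, ENNReal.ofReal_inv_of_pos (Real.exp_pos _), ENNReal.le_inv_iff_mul_le, mul_comm]
  exact h4

end Probability

end CacoInput

/-! ### Grids for the information of an arm -/

/-- The ratio between the square roots of consecutive centers of the fine grid is
`exp (2 * fineStep N)`. It is chosen so that `cosh (fineStep N) ≤ 1 + 1 / (8 √N)`. -/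
noncomputable def fineStep (N : ℕ) : ℝ := 9 / (20 * √(√N))

/-- The centers of the fine grid on `[1, N]`. -/
noncomputable def fineCenter (N r : ℕ) : ℝ := Real.exp (4 * fineStep N * (r + 1 / 2))

/-- The centers of the coarse grid. -/
noncomputable def coarseCenter (r : ℕ) : ℝ := 9 / 4 * 4 ^ r

/-- The number of points that the fine grid needs to cover `[1, N]`. -/
noncomputable def fineSize (N : ℕ) : ℕ := ⌊(41 / 50 : ℝ) * √N⌋₊ + 1

/-- The number of points that the coarse grid needs to cover `[1, N]`. -/
def coarseSize (N : ℕ) : ℕ := Nat.log 4 N + 1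

theorem fineCenter_pos (N r : ℕ) : 0 < fineCenter N r := Real.exp_pos _

theorem coarseCenter_pos (r : ℕ) : 0 < coarseCenter r := by unfold coarseCenter; positivity

theorem cosh_fineStep_le {N : ℕ} (hN : 2 ≤ N) :
    Real.cosh (fineStep N) ≤ 1 + 1 / (8 * √N) := by
  have hN' : (2 : ℝ) ≤ N := by exact_mod_cast hN
  have hs : (7 / 5 : ℝ) ≤ √N := Real.le_sqrt_of_sq_le (by norm_num; linarith)
  refine (Real.cosh_le_exp_half_sq _).trans ?_
  have e : fineStep N ^ 2 / 2 = 81 / 800 / √N := by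
    unfold fineStep
    rw [div_pow, mul_pow, Real.sq_sqrt (Real.sqrt_nonneg _)]
    field_simp
    norm_num
  rw [e]
  set y : ℝ := 81 / 800 / √N with hy
  have hy0 : 0 < y := by positivity
  have hy1 : y ≤ 3 / 40 := by
    rw [hy, div_le_iff₀ (by linarith)]
    linarith
  have e2 : 1 + 1 / (8 * √N) = 1 + 100 / 81 * y := by
    rw [hy]
    field_simp
    ring
  rw [e2]
  refine (Real.exp_bound_div_one_sub_of_interval hy0.le (by linarith)).trans ?_
  rw [div_le_iff₀ (by linarith)]
  nlinarith

/-- Every point of `[1, N]` is close to a center of the fine grid. -/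
theorem exists_fine_center {N : ℕ} (hN : 2 ≤ N) {y : ℝ} (h1 : 1 ≤ y) (h2 : y ≤ N) :
    ∃ r ∈ range (fineSize N), y / fineCenter N r + 1 ≤
      2 * (1 + 1 / (8 * √N)) * √(y / fineCenter N r) := by
  have hN' : (2 : ℝ) ≤ N := by exact_mod_cast hN
  have hy0 : 0 < y := by linarith
  have hsN : 0 < √(N : ℝ) := Real.sqrt_pos.mpr (by linarith)
  have hq : 0 < √√(N : ℝ) := Real.sqrt_pos.mpr hsN
  set τ := fineStep N with hτ
  have hτ0 : 0 < τ := by rw [hτ]; unfold fineStep; positivity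
  have hlog0 : 0 ≤ Real.log y := Real.log_nonneg h1
  set z := Real.log y / (4 * τ) with hz
  have hz0 : 0 ≤ z := by positivity
  have hlogz : Real.log y = 4 * τ * z := by rw [hz]; field_simp
  refine ⟨⌊z⌋₊, mem_range.mpr (Nat.lt_succ_of_le (Nat.floor_le_floor ?_)), ?_⟩
  · -- `log N = 4 log (N ^ (1 / 4)) ≤ 4 N ^ (1 / 4) / e`
    have h3 : Real.log y ≤ 4 * Real.log (√√(N : ℝ)) := by
      rw [Real.log_sqrt hsN.le, Real.log_sqrt (by linarith)]
      have := Real.log_le_log hy0 h2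
      linarith
    have h4 : Real.log (√√(N : ℝ)) ≤ √√(N : ℝ) / Real.exp 1 := by
      have := Real.log_le_sub_one_of_pos (x := √√(N : ℝ) / Real.exp 1) (by positivity)
      rw [Real.log_div hq.ne' (Real.exp_pos _).ne', Real.log_exp] at this
      linarith
    have h5 : √√(N : ℝ) / Real.exp 1 ≤ √√(N : ℝ) * (369 / 1000) := by
      rw [div_le_iff₀ (Real.exp_pos _), mul_assoc]
      refine le_mul_of_one_le_right hq.le ?_
      have := Real.exp_one_gt_d9
      linarith
    have h6 : √√(N : ℝ) * √√(N : ℝ) = √N := Real.mul_self_sqrt hsN.le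
    rw [hz, hτ, div_le_iff₀ (by positivity)]
    unfold fineStep
    rw [show 41 / 50 * √(N : ℝ) * (4 * (9 / (20 * √√(N : ℝ)))) =
      (√√(N : ℝ) * √√(N : ℝ)) * (369 / 250) / √√(N : ℝ) by rw [h6]; field_simp; norm_num,
      mul_assoc, mul_div_assoc, mul_div_right_comm]
    field_simp
    linarith
  · have hf1 := Nat.floor_le hz0
    have hf2 := Nat.lt_floor_add_one z
    set d := 2 * τ * (z - ⌊z⌋₊ - 1 / 2) with hd
    have hr : y / fineCenter N ⌊z⌋₊ = Real.exp d ^ 2 := by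
      unfold fineCenter
      rw [← hτ, ← Real.exp_nat_mul, ← Real.exp_log hy0, ← Real.exp_sub, hlogz]
      congr 1
      rw [hd]
      push_cast
      ring
    rw [hr, Real.sqrt_sq (Real.exp_pos _).le]
    have hcosh : Real.cosh d ≤ 1 + 1 / (8 * √N) := by
      refine le_trans ?_ (cosh_fineStep_le hN)
      rw [Real.cosh_le_cosh, abs_of_pos hτ0, abs_le]
      constructor <;> rw [hd] <;> nlinarith
    have hsum : Real.exp d ^ 2 + 1 = 2 * Real.cosh d * Real.exp d := by
      rw [Real.cosh_eq, Real.exp_neg]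
      field_simp
    rw [hsum]
    have := Real.exp_pos d
    gcongr

/-- Every point of `[1, N]` is within a constant factor of a center of the coarse grid. -/
theorem exists_coarse_center {N : ℕ} {y : ℝ} (h1 : 1 ≤ y) (h2 : y ≤ N) :
    ∃ r ∈ range (coarseSize N),
      8 / 9 ≤ 2 * √(y / coarseCenter r) - y / coarseCenter r := by
  set k := ⌊y⌋₊ with hk
  have hk1 : 1 ≤ k := Nat.le_floor (by simpa using h1)
  have hkN : k ≤ N := Nat.floor_le_of_le h2
  refine ⟨Nat.log 4 k, mem_range.mpr (Nat.lt_succ_of_le (Nat.log_mono_right hkN)), ?_⟩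
  have h3 : (4 : ℝ) ^ Nat.log 4 k ≤ y := by
    have : 4 ^ Nat.log 4 k ≤ k := Nat.pow_log_le_self 4 (by omega)
    have h4 : ((4 ^ Nat.log 4 k : ℕ) : ℝ) ≤ k := by exact_mod_cast this
    push_cast at h4
    exact h4.trans (Nat.floor_le (by linarith))
  have h4 : y ≤ 4 * (4 : ℝ) ^ Nat.log 4 k := by
    have : k + 1 ≤ 4 ^ (Nat.log 4 k + 1) := Nat.lt_pow_succ_log_self (by norm_num) k
    have h5 : ((k + 1 : ℕ) : ℝ) ≤ ((4 ^ (Nat.log 4 k + 1) : ℕ) : ℝ) := by exact_mod_cast this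
    push_cast at h5
    rw [pow_succ] at h5
    linarith [Nat.lt_floor_add_one y]
  have hp : (0 : ℝ) < 4 ^ Nat.log 4 k := by positivity
  set w := y / coarseCenter (Nat.log 4 k) with hw
  have hw1 : 4 / 9 ≤ w := by
    rw [hw, le_div_iff₀ (coarseCenter_pos _)]; unfold coarseCenter; linarith
  have hw2 : w ≤ 16 / 9 := by
    rw [hw, div_le_iff₀ (coarseCenter_pos _)]; unfold coarseCenter; linarith
  have hs1 : 2 / 3 ≤ √w := Real.le_sqrt_of_sq_le (by linarith)
  have hs2 : √w ≤ 4 / 3 := Real.sqrt_le_left (by norm_num) |>.mpr (by linarith)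
  have hs3 : √w ^ 2 = w := Real.sq_sqrt (by linarith)
  nlinarith

theorem fineSize_le (N : ℕ) : (fineSize N : ℝ) ≤ 41 / 50 * √N + 1 := by
  unfold fineSize
  push_cast
  linarith [Nat.floor_le (a := (41 / 50 : ℝ) * √N) (by positivity)]

theorem coarseSize_sq_le {N : ℕ} (hN : N ≠ 0) : (coarseSize N : ℝ) ^ 2 ≤ 9 / 4 * √N := by
  have key : ∀ k : ℕ, 4 * (k + 1) ^ 2 ≤ 9 * 2 ^ k := by
    intro k
    induction k using Nat.strong_induction_on with
    | _ k ih =>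
      rcases Nat.lt_or_ge k 3 with h | h
      · interval_cases k <;> norm_num
      · obtain ⟨d, rfl⟩ := Nat.exists_eq_add_of_le h
        have := ih (2 + d) (by omega)
        rw [show 3 + d = (2 + d) + 1 by omega, pow_succ 2 (2 + d)]
        nlinarith
  have h1 : (2 : ℝ) ^ Nat.log 4 N ≤ √N := by
    refine Real.le_sqrt_of_sq_le ?_
    rw [← pow_mul, mul_comm, pow_mul]
    have : 4 ^ Nat.log 4 N ≤ N := Nat.pow_log_le_self 4 hN
    norm_num
    exact_mod_cast this
  have h2 : (4 : ℝ) * (Nat.log 4 N + 1) ^ 2 ≤ 9 * 2 ^ Nat.log 4 N := by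
    exact_mod_cast key (Nat.log 4 N)
  unfold coarseSize
  push_cast
  linarith

/-- The choice of the direction of an exponential supermartingale that detects deviations at
information `V` near `v * c`. -/
theorem le_exponent {σ L V v c κ κ' S b : ℝ} (hσ : 0 < σ) (hL : 0 ≤ L) (hv : 0 < v)
    (hc : 0 < c) (hκ : 0 ≤ κ) (hS : κ' * (σ * √(2 * V * L)) ≤ S)
    (hb : b ≤ 2 * κ * κ' * √(V / v / c) - κ ^ 2 * (V / v / c)) :
    L * b ≤
      (κ * √(2 * L / (v * c)) / σ) * S - (κ * √(2 * L / (v * c)) / σ) ^ 2 * σ ^ 2 * V / 2 := by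
  set l := κ * √(2 * L / (v * c)) / σ with hl
  have hl0 : 0 ≤ l := by positivity
  have e1 : l * (κ' * (σ * √(2 * V * L))) = L * (2 * κ * κ' * √(V / v / c)) := by
    have : √(2 * L / (v * c)) * √(2 * V * L) = 2 * L * √(V / v / c) := by
      rw [← Real.sqrt_mul (by positivity), show 2 * L / (v * c) * (2 * V * L) =
        (2 * L) ^ 2 * (V / v / c) by field_simp, Real.sqrt_mul (by positivity),
        Real.sqrt_sq (by positivity)]
    rw [hl]
    calc κ * √(2 * L / (v * c)) / σ * (κ' * (σ * √(2 * V * L)))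
        = κ * κ' * (√(2 * L / (v * c)) * √(2 * V * L)) := by field_simp
      _ = _ := by rw [this]; ring
  have e2 : l ^ 2 * σ ^ 2 * V / 2 = L * (κ ^ 2 * (V / v / c)) := by
    rw [hl, div_pow, mul_pow, Real.sq_sqrt (by positivity)]
    field_simp
  have h1 := mul_le_mul_of_nonneg_left hS hl0
  have h2 := mul_le_mul_of_nonneg_left hb hL
  rw [e1] at h1
  rw [e2]
  linarith

/-! ### Accuracy with high probability -/

namespace CacoInput

variable {n : ℕ} {I : CacoInput n} {u : Fin n → ℝ}

/-- The contribution of one arm to `logMart`, in direction `l`. -/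
noncomputable def armMart (I : CacoInput n) (u : Fin n → ℝ) (st : CacoState n) (a : Fin n)
    (l : ℝ) : ℝ :=
  l * (st.wsum a - u a * st.info a) - l ^ 2 * I.σ ^ 2 * st.info a / 2

theorem logMart_single (st : CacoState n) (a : Fin n) (l : ℝ) :
    I.logMart u (Pi.single a l) st = I.armMart u st a l := by
  unfold logMart
  rw [sum_eq_single a]
  · simp [armMart]
  · intro b _ hb
    simp [Pi.single_eq_of_ne hb]
  · simp

theorem logMart_pair (st : CacoState n) {a b : Fin n} (hab : a ≠ b) (l l' : ℝ) :
    I.logMart u (Pi.single a l + Pi.single b l') st =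
      I.armMart u st a l + I.armMart u st b l' := by
  unfold logMart
  rw [← add_sum_erase _ _ (mem_univ a), ← add_sum_erase _ _ (mem_erase.mpr ⟨hab.symm, mem_univ b⟩),
    sum_eq_zero]
  · simp [armMart, Pi.single_eq_of_ne hab, Pi.single_eq_of_ne hab.symm]
  · intro c hc
    rw [mem_erase, mem_erase] at hc
    simp [Pi.single_eq_of_ne hc.1, Pi.single_eq_of_ne hc.2.1]

/-- The time of the check in stage `i` before which exactly `N` pulls were made. -/
def checkTime (I : CacoInput n) (N i : ℕ) : ℕ := N + 2 * i + 1 - I.firstPulls (i + 1)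

/-- A lower bound on the logarithm in the confidence radius after `N` pulls. -/
noncomputable def level (I : CacoInput n) (N : ℕ) : ℝ := Real.log (8 * N ^ 3 / I.δ)

/-- The sign encoded by a truth value. -/
def boolSign (s : Bool) : ℝ := if s then 1 else -1

theorem boolSign_sq (s : Bool) : boolSign s ^ 2 = 1 := by
  cases s <;> simp [boolSign]

theorem exists_boolSign_mul (y : ℝ) : ∃ s, boolSign s * y = |y| := by
  rcases le_total 0 y with h | h
  · exact ⟨true, by simp [boolSign, abs_of_nonneg h]⟩
  · exact ⟨false, by simp [boolSign, abs_of_nonpos h]⟩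

/-- The direction of the supermartingale that detects deviations of size `κ` radii in stage `i`
after `N` pulls, for arms whose information is near `c` times the largest gain. -/
noncomputable def direction (I : CacoInput n) (N i : ℕ) (κ c : ℝ) : ℝ :=
  κ * √(2 * I.level N / (I.maxGain i * c)) / I.σ

/-- The direction in which the deviation of a single arm is detected; the index gives the arm, the
sign of the deviation and the center of the fine grid. -/
noncomputable def singleDir (I : CacoInput n) (N i : ℕ) (q : Fin n × Bool × ℕ) : Fin n → ℝ :=
  Pi.single q.1 (boolSign q.2.1 * I.direction N i 1 (fineCenter N q.2.2))

/-- The direction in which the joint deviation of two arms is detected; the index gives the arms,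
the signs and the centers of the coarse grid. -/
noncomputable def pairDir (I : CacoInput n) (N i : ℕ)
    (q : (Fin n × Fin n) × (Bool × Bool) × (ℕ × ℕ)) : Fin n → ℝ :=
  Pi.single q.1.1 (boolSign q.2.1.1 * I.direction N i (7 / 8) (coarseCenter q.2.2.1)) +
    Pi.single q.1.2 (boolSign q.2.1.2 * I.direction N i (7 / 8) (coarseCenter q.2.2.2))

/-- The index set of the directions `singleDir`. -/
noncomputable def singleIdx (n N : ℕ) : Finset (Fin n × Bool × ℕ) :=
  univ ×ˢ univ ×ˢ range (fineSize N)

/-- The index set of the directions `pairDir`: each unordered pair of arms occurs once. -/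
def pairIdx (n N : ℕ) : Finset ((Fin n × Fin n) × (Bool × Bool) × (ℕ × ℕ)) :=
  univ.filter (fun p : Fin n × Fin n => p.1 < p.2) ×ˢ univ ×ˢ
    (range (coarseSize N) ×ˢ range (coarseSize N))

theorem card_singleIdx (n N : ℕ) : (singleIdx n N).card = n * (2 * fineSize N) := by
  simp [singleIdx]

theorem card_pairIdx_le (n N : ℕ) : (pairIdx n N).card ≤ 2 * n ^ 2 * coarseSize N ^ 2 := by
  have h : 2 * (univ.filter (fun p : Fin n × Fin n => p.1 < p.2)).card ≤ n ^ 2 := by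
    have e : (univ.filter (fun p : Fin n × Fin n => p.1 < p.2)).card =
        (univ.filter (fun p : Fin n × Fin n => p.2 < p.1)).card :=
      card_bij (fun p _ => (p.2, p.1)) (by simp) (by simp +contextual [Prod.ext_iff]) (by simp)
    have hd : Disjoint (univ.filter (fun p : Fin n × Fin n => p.1 < p.2))
        (univ.filter (fun p : Fin n × Fin n => p.2 < p.1)) := by
      rw [disjoint_filter]
      intro p _ h
      exact h.not_gt
    calc 2 * (univ.filter (fun p : Fin n × Fin n => p.1 < p.2)).card
        = (univ.filter (fun p : Fin n × Fin n => p.1 < p.2)).card +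
          (univ.filter (fun p : Fin n × Fin n => p.2 < p.1)).card := by rw [← e]; ring
      _ ≤ (univ : Finset (Fin n × Fin n)).card := by
          rw [← card_union_of_disjoint hd]; exact card_le_univ _
      _ = n ^ 2 := by simp [sq]
  simp only [pairIdx, card_product, card_univ, Fintype.card_prod, Fintype.card_bool, card_range]
  nlinarith [Nat.zero_le (coarseSize N ^ 2)]

/-- None of the deviations that the directions detect occurs at the check in stage `i` after `N`
pulls. -/
def NoDeviation (I : CacoInput n) (u : Fin n → ℝ) (N i : ℕ) (st : CacoState n) : Prop :=
  (∀ q ∈ singleIdx n N, I.logMart u (I.singleDir N i q) st < I.level N) ∧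
    ∀ q ∈ pairIdx n N, I.logMart u (I.pairDir N i q) st < 4 / 3 * I.level N

theorem level_pos (hI : I.Valid) {N : ℕ} (hN : 2 ≤ N) : 0 < I.level N := by
  have h2 : (2 : ℝ) ≤ N := by exact_mod_cast hN
  have h3 : (1 : ℝ) ≤ (N : ℝ) ^ 3 := one_le_pow₀ (by linarith)
  have hδ := hI.δ_mem
  refine Real.log_pos ?_
  rw [lt_div_iff₀ hδ.1]
  nlinarith [hδ.2]

/-- A deviation of `κ'` radii at information near `c` times the largest gain makes the exponent of
the supermartingale large, for one of the two signs of the direction. -/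
theorem le_armMart (hI : I.Valid) {N i : ℕ} (hN : 2 ≤ N) {st : CacoState n} {a : Fin n}
    {c κ κ' b : ℝ} (hc : 0 < c) (hκ : 0 ≤ κ)
    (hS : κ' * (I.σ * √(2 * st.info a * I.level N)) ≤ |st.wsum a - u a * st.info a|)
    (hb : b ≤ 2 * κ * κ' * √(st.info a / I.maxGain i / c) -
      κ ^ 2 * (st.info a / I.maxGain i / c)) :
    ∃ s, I.level N * b ≤ I.armMart u st a (boolSign s * I.direction N i κ c) := by
  obtain ⟨s, hs⟩ := exists_boolSign_mul (st.wsum a - u a * st.info a)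
  rw [← hs] at hS
  refine ⟨s, (le_exponent hI.σ_pos (level_pos hI hN).le (maxGain_pos hI i) hc hκ hS hb).trans
    (le_of_eq ?_)⟩
  unfold armMart direction
  rw [mul_pow, boolSign_sq]
  ring

/-- Absence of detected deviations makes the estimates accurate. The deviation of a single arm is
excluded only beyond `1 + 1 / (8 √N)` radii, but then the other arm of a pair deviates by at most
`7 / 8` of its radius, and radii differ at most by the factor `√N`. -/
theorem NoDeviation.pairAccurate (hI : I.Valid) {N : ℕ} (hN : n ≤ N) {st : CacoState n}
    (hs : st.stage < I.m) (hcost : (N : ℝ) ≤ st.cost)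
    (hinfo : ∀ a ∈ st.active st.stage, I.maxGain st.stage ≤ st.info a ∧
      st.info a ≤ N * I.maxGain st.stage)
    (h : I.NoDeviation u N st.stage st) : I.PairAccurate u st := by
  have hN2 : 2 ≤ N := hI.two_le_n.trans hN
  have hN2' : (2 : ℝ) ≤ N := by exact_mod_cast hN2
  have hL := level_pos hI hN2
  have hv := maxGain_pos hI st.stage
  have hσ := hI.σ_pos
  set L := I.level N
  set v := I.maxGain st.stage
  set η : ℝ := 1 / (8 * √N) with hη
  have hinfo' : ∀ a ∈ st.active st.stage, 1 ≤ st.info a / v ∧ st.info a / v ≤ N := fun a ha => by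
    rw [le_div_iff₀ hv, div_le_iff₀ hv, one_mul]
    exact hinfo a ha
  have hpos : ∀ a ∈ st.active st.stage, 0 < st.info a := fun a ha => hv.trans_le (hinfo a ha).1
  have hsingle : ∀ a ∈ st.active st.stage,
      |st.wsum a - u a * st.info a| < (1 + η) * (I.σ * √(2 * st.info a * L)) := by
    intro a ha
    by_contra hcon
    rw [not_lt] at hcon
    obtain ⟨r, hr, hr2⟩ := exists_fine_center hN2 (hinfo' a ha).1 (hinfo' a ha).2
    obtain ⟨s, hs⟩ := le_armMart (i := st.stage) (κ := 1) (b := 1) hI hN2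
      (fineCenter_pos N r) zero_le_one hcon
      (by linarith)
    have := h.1 (a, s, r) (by simpa [singleIdx] using hr)
    unfold singleDir at this
    rw [logMart_single] at this
    simp only at this
    linarith
  have hdouble : ∀ a ∈ st.active st.stage, ∀ b ∈ st.active st.stage, a < b →
      |st.wsum a - u a * st.info a| < 7 / 8 * (I.σ * √(2 * st.info a * L)) ∨
      |st.wsum b - u b * st.info b| < 7 / 8 * (I.σ * √(2 * st.info b * L)) := by
    intro a ha b hb hab
    by_contra! hcon
    obtain ⟨r, hr, hr2⟩ := exists_coarse_center (hinfo' a ha).1 (hinfo' a ha).2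
    obtain ⟨r', hr', hr2'⟩ := exists_coarse_center (hinfo' b hb).1 (hinfo' b hb).2
    obtain ⟨s, hs⟩ := le_armMart (i := st.stage) (κ := 7 / 8) (b := 2 / 3) hI hN2
      (coarseCenter_pos r) (by norm_num)
      hcon.1 (by linarith)
    obtain ⟨s', hs'⟩ := le_armMart (i := st.stage) (κ := 7 / 8) (b := 2 / 3) hI hN2
      (coarseCenter_pos r')
      (by norm_num) hcon.2 (by linarith)
    have := h.2 ((a, b), (s, s'), (r, r')) (by
      simp only [pairIdx, mem_product, mem_filter, mem_univ, true_and]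
      exact ⟨hab, hr, hr'⟩)
    unfold pairDir at this
    rw [logMart_pair _ hab.ne] at this
    simp only at this
    linarith
  -- the radii that correspond to `L`; the true radii are larger
  set ρ : Fin n → ℝ := fun a => I.σ * √(2 * L / st.info a) with hρ
  have hρ0 : ∀ a, 0 ≤ ρ a := fun a => mul_nonneg hσ.le (Real.sqrt_nonneg _)
  have hρrad : ∀ a ∈ st.active st.stage, ρ a ≤ I.rad st a := by
    intro a ha
    have hK : (2 : ℝ) ≤ I.K st.stage := by exact_mod_cast hI.two_le_K hs
    have hδ := hI.δ_mem.1
    have := hpos a ha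
    have hle : L ≤ Real.log (4 * (I.K st.stage : ℝ) * st.cost ^ 3 / I.δ) := by
      refine Real.log_le_log (by positivity) ?_
      have : (N : ℝ) ^ 3 ≤ st.cost ^ 3 := pow_le_pow_left₀ (by linarith) hcost 3
      have h3 : (0 : ℝ) ≤ (N : ℝ) ^ 3 := by positivity
      gcongr ?_ / _
      nlinarith
    unfold rad
    rw [hρ]
    dsimp only
    gcongr
  have hdev : ∀ a ∈ st.active st.stage, ∀ κ, |st.wsum a - u a * st.info a| <
      κ * (I.σ * √(2 * st.info a * L)) → |st.mean a - u a| ≤ κ * ρ a := by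
    intro a ha κ hκ
    have hV := hpos a ha
    have e1 : st.mean a - u a = (st.wsum a - u a * st.info a) / st.info a := by
      unfold CacoState.mean
      field_simp
    have e2 : √(2 * st.info a * L) = √(2 * L / st.info a) * st.info a := by
      rw [show 2 * st.info a * L = 2 * L / st.info a * st.info a ^ 2 by field_simp,
        Real.sqrt_mul (by positivity), Real.sqrt_sq hV.le]
    rw [e1, abs_div, abs_of_pos hV, div_le_iff₀ hV]
    rw [e2] at hκ
    rw [hρ]
    dsimp only
    linarith
  have hratio : ∀ a ∈ st.active st.stage, ∀ b ∈ st.active st.stage, η * ρ a ≤ ρ b / 8 := by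
    intro a ha b hb
    have h1 : √(2 * L / st.info a) ≤ √N * √(2 * L / st.info b) := by
      rw [← Real.sqrt_mul (by positivity)]
      refine Real.sqrt_le_sqrt ?_
      have hVa := hpos a ha
      have hVb := hpos b hb
      have h2 : st.info b ≤ N * st.info a := (hinfo b hb).2.trans
        (mul_le_mul_of_nonneg_left (hinfo a ha).1 (by linarith))
      rw [mul_div_assoc', div_le_div_iff₀ hVa hVb]
      nlinarith
    have hsN : 0 < √(N : ℝ) := Real.sqrt_pos.mpr (by linarith)
    have h2 : ρ a ≤ √N * ρ b := by
      rw [hρ]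
      dsimp only
      calc I.σ * √(2 * L / st.info a) ≤ I.σ * (√N * √(2 * L / st.info b)) := by gcongr
        _ = _ := by ring
    rw [hη, one_div, mul_inv, mul_assoc, inv_mul_le_iff₀ (by norm_num), inv_mul_le_iff₀ hsN]
    linarith
  intro a ha b hb hab
  have h1 := hdev a ha _ (hsingle a ha)
  have h2 := hdev b hb _ (hsingle b hb)
  have h3 := hratio a ha b hb
  have h4 := hratio b hb a ha
  have h5 := hρrad a ha
  have h6 := hρrad b hb
  have h7 : |st.mean a - u a| ≤ 7 / 8 * ρ a ∨ |st.mean b - u b| ≤ 7 / 8 * ρ b := by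
    rcases lt_or_gt_of_ne hab with hlt | hlt
    · exact (hdouble a ha b hb hlt).imp (hdev a ha _) (hdev b hb _)
    · exact ((hdouble b hb a ha hlt).imp (hdev b hb _) (hdev a ha _)).symm
  rcases h7 with h7 | h7 <;> linarith

theorem exp_neg_level (hI : I.Valid) {N : ℕ} (hN : 2 ≤ N) :
    Real.exp (-I.level N) = I.δ / (8 * N ^ 3) := by
  have h2 : (2 : ℝ) ≤ N := by exact_mod_cast hN
  have hδ := hI.δ_mem.1
  unfold level
  rw [← Real.log_inv, Real.exp_log (by positivity), inv_div]

theorem exp_neg_level_four_thirds_le (hI : I.Valid) {N : ℕ} (hN : 2 ≤ N) :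
    Real.exp (-(4 / 3 * I.level N)) ≤ I.δ / (16 * N ^ 4) := by
  have h2 : (2 : ℝ) ≤ N := by exact_mod_cast hN
  have hδ := hI.δ_mem
  have hδ0 := hδ.1
  rw [← Real.le_log_iff_exp_le (by positivity)]
  have hlog : Real.log I.δ ≤ 0 := Real.log_nonpos hδ.1.le hδ.2.le
  unfold level
  rw [Real.log_div (by positivity) (by positivity), Real.log_div (by positivity) (by positivity),
    Real.log_mul (by norm_num) (by positivity), Real.log_mul (by norm_num) (by positivity),
    Real.log_pow, Real.log_pow, show (8 : ℝ) = 2 ^ 3 by norm_num,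
    show (16 : ℝ) = 2 ^ 4 by norm_num, Real.log_pow, Real.log_pow]
  push_cast
  linarith

section Probability

variable {Ω : Type*} [MeasurableSpace Ω] {P : Measure Ω} [IsProbabilityMeasure P]
  {X : ℕ → ℕ → Fin n → Ω → ℝ}

theorem measure_not_noDeviation_le (hI : I.Valid)
    (hX : ∀ t, ∀ i < I.m, ∀ a, Measurable (X t i a))
    (hind : iIndepFun (fun q : ℕ × Fin I.m × Fin n => X q.1 (q.2.1 : ℕ) q.2.2) P)
    (hsub : ∀ t, ∀ i < I.m, ∀ a, HasSubgaussianMGF (fun ω => X t i a ω - u a)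
      (Real.toNNReal (I.σ ^ 2 / I.s i)) P)
    {N : ℕ} (hN : n ≤ N) (i : ℕ) :
    P {ω | ¬ I.NoDeviation u N i (I.run (fun t i a => X t i a ω) (I.checkTime N i))} ≤
      ENNReal.ofReal (I.δ * (n / (8 * N ^ 3) * (389 / 100 * √N + 2))) := by
  have hN2 : 2 ≤ N := hI.two_le_n.trans hN
  have hN2' : (2 : ℝ) ≤ N := by exact_mod_cast hN2
  have hδ := hI.δ_mem.1
  set R : Ω → CacoState n := fun ω => I.run (fun t i a => X t i a ω) (I.checkTime N i) with hR
  have hsubset : {ω | ¬ I.NoDeviation u N i (R ω)} ⊆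
      (⋃ q ∈ singleIdx n N, {ω | I.level N ≤ I.logMart u (I.singleDir N i q) (R ω)}) ∪
      ⋃ q ∈ pairIdx n N, {ω | 4 / 3 * I.level N ≤ I.logMart u (I.pairDir N i q) (R ω)} := by
    intro ω hω
    simp only [Set.mem_ofPred_eq, NoDeviation] at hω
    by_contra hcon
    simp only [Set.mem_union, Set.mem_iUnion, Set.mem_ofPred_eq, not_or, not_exists, not_le] at hcon
    exact hω ⟨hcon.1, hcon.2⟩
  have h1 : P (⋃ q ∈ singleIdx n N, {ω | I.level N ≤ I.logMart u (I.singleDir N i q) (R ω)}) ≤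
      ENNReal.ofReal ((singleIdx n N).card * (I.δ / (8 * N ^ 3))) := by
    refine (measure_biUnion_finset_le _ _).trans ((sum_le_card_nsmul _ _
      (ENNReal.ofReal (I.δ / (8 * N ^ 3))) fun q _ => ?_).trans ?_)
    · rw [← exp_neg_level hI hN2]
      exact measure_le_logMart hI hX hind hsub _ _ _
    · rw [nsmul_eq_mul, ENNReal.ofReal_mul (Nat.cast_nonneg _), ENNReal.ofReal_natCast]
  have h2 : P (⋃ q ∈ pairIdx n N,
      {ω | 4 / 3 * I.level N ≤ I.logMart u (I.pairDir N i q) (R ω)}) ≤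
      ENNReal.ofReal ((pairIdx n N).card * (I.δ / (16 * N ^ 4))) := by
    refine (measure_biUnion_finset_le _ _).trans ((sum_le_card_nsmul _ _
      (ENNReal.ofReal (I.δ / (16 * N ^ 4))) fun q _ => ?_).trans ?_)
    · exact (measure_le_logMart hI hX hind hsub _ _ _).trans
        (ENNReal.ofReal_le_ofReal (exp_neg_level_four_thirds_le hI hN2))
    · rw [nsmul_eq_mul, ENNReal.ofReal_mul (Nat.cast_nonneg _), ENNReal.ofReal_natCast]
  refine (measure_mono hsubset).trans ((measure_union_le _ _).trans ((add_le_add h1 h2).trans ?_))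
  rw [← ENNReal.ofReal_add (by positivity) (by positivity)]
  refine ENNReal.ofReal_le_ofReal ?_
  have c1 : ((singleIdx n N).card : ℝ) ≤ n * (2 * (41 / 50 * √N + 1)) := by
    rw [card_singleIdx]
    push_cast
    have := fineSize_le N
    gcongr
  have c2 : ((pairIdx n N).card : ℝ) ≤ 2 * n * N * (9 / 4 * √N) := by
    have h3 : ((pairIdx n N).card : ℝ) ≤ 2 * (n : ℝ) ^ 2 * (coarseSize N : ℝ) ^ 2 := by
      exact_mod_cast card_pairIdx_le n N
    have h4 := coarseSize_sq_le (N := N) (by omega)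
    have h5 : (n : ℝ) ≤ N := by exact_mod_cast hN
    calc ((pairIdx n N).card : ℝ) ≤ 2 * (n : ℝ) ^ 2 * (coarseSize N : ℝ) ^ 2 := h3
      _ = 2 * n * n * (coarseSize N : ℝ) ^ 2 := by ring
      _ ≤ 2 * n * N * (9 / 4 * √N) := by gcongr
  calc ((singleIdx n N).card : ℝ) * (I.δ / (8 * N ^ 3)) +
        ((pairIdx n N).card : ℝ) * (I.δ / (16 * N ^ 4))
      ≤ n * (2 * (41 / 50 * √N + 1)) * (I.δ / (8 * N ^ 3)) +
        2 * n * N * (9 / 4 * √N) * (I.δ / (16 * N ^ 4)) := by gcongr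
    _ = I.δ * (n / (8 * N ^ 3) * (389 / 100 * √N + 2)) := by
        field_simp
        ring

/-- The union bound over the stages that can be running after `N` pulls: these are at most
`√(2 N) - 1` many. -/
theorem measure_exists_stage_le (hI : I.Valid)
    (hX : ∀ t, ∀ i < I.m, ∀ a, Measurable (X t i a))
    (hind : iIndepFun (fun q : ℕ × Fin I.m × Fin n => X q.1 (q.2.1 : ℕ) q.2.2) P)
    (hsub : ∀ t, ∀ i < I.m, ∀ a, HasSubgaussianMGF (fun ω => X t i a ω - u a)
      (Real.toNNReal (I.σ ^ 2 / I.s i)) P)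
    {N : ℕ} (hN : n ≤ N) :
    P {ω | ∃ i, (i + 2) ^ 2 ≤ 2 * N ∧
      ¬ I.NoDeviation u N i (I.run (fun t i a => X t i a ω) (I.checkTime N i))} ≤
      ENNReal.ofReal (I.δ * (172 / 250 * n / N ^ 2)) := by
  have hN2 : 2 ≤ N := hI.two_le_n.trans hN
  have hN2' : (2 : ℝ) ≤ N := by exact_mod_cast hN2
  have hδ := hI.δ_mem.1
  have hsubset : {ω | ∃ i, (i + 2) ^ 2 ≤ 2 * N ∧
      ¬ I.NoDeviation u N i (I.run (fun t i a => X t i a ω) (I.checkTime N i))} ⊆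
      ⋃ i ∈ range (Nat.sqrt (2 * N) - 1), {ω |
        ¬ I.NoDeviation u N i (I.run (fun t i a => X t i a ω) (I.checkTime N i))} := by
    rintro ω ⟨i, hi, hω⟩
    simp only [Set.mem_iUnion]
    refine ⟨i, mem_range.mpr ?_, hω⟩
    have : i + 2 ≤ Nat.sqrt (2 * N) := Nat.le_sqrt'.mpr hi
    omega
  refine (measure_mono hsubset).trans ((measure_biUnion_finset_le _ _).trans
    ((sum_le_card_nsmul _ _ _ fun i _ =>
      measure_not_noDeviation_le hI hX hind hsub hN i).trans ?_))
  rw [nsmul_eq_mul, card_range, ← ENNReal.ofReal_natCast, ← ENNReal.ofReal_mul (Nat.cast_nonneg _)]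
  refine ENNReal.ofReal_le_ofReal ?_
  have hs2 : 2 ≤ Nat.sqrt (2 * N) := Nat.le_sqrt'.mpr (by omega)
  have hcard : ((Nat.sqrt (2 * N) - 1 : ℕ) : ℝ) ≤ 14143 / 10000 * √N - 1 := by
    rw [Nat.cast_sub (by omega)]
    have h1 : (Nat.sqrt (2 * N) : ℝ) ≤ √((2 * N : ℕ) : ℝ) := Real.nat_sqrt_le_real_sqrt
    push_cast at h1 ⊢
    rw [Real.sqrt_mul (by norm_num)] at h1
    have h2 : √(2 : ℝ) ≤ 14143 / 10000 := Real.sqrt_le_left (by norm_num) |>.mpr (by norm_num)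
    have := mul_le_mul_of_nonneg_right h2 (Real.sqrt_nonneg (N : ℝ))
    linarith
  set q := √(N : ℝ) with hq
  have hq2 : q ^ 2 = N := Real.sq_sqrt (by linarith)
  have hq0 : 0 ≤ q := Real.sqrt_nonneg _
  calc ((Nat.sqrt (2 * N) - 1 : ℕ) : ℝ) * (I.δ * (n / (8 * N ^ 3) * (389 / 100 * q + 2)))
      ≤ (14143 / 10000 * q - 1) * (I.δ * (n / (8 * N ^ 3) * (389 / 100 * q + 2))) := by gcongr
    _ = I.δ * (n / (8 * N ^ 3)) * ((14143 / 10000 * q - 1) * (389 / 100 * q + 2)) := by ring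
    _ ≤ I.δ * (n / (8 * N ^ 3)) * (172 / 250 * 8 * N) := by
        refine mul_le_mul_of_nonneg_left ?_ (by positivity)
        rw [← hq2]
        nlinarith
    _ = I.δ * (172 / 250 * n / N ^ 2) := by field_simp

theorem sum_inv_sq_le {n : ℕ} (hn : 2 ≤ n) (k : ℕ) :
    ∑ e ∈ range k, 1 / ((n + e : ℕ) : ℝ) ^ 2 ≤ 1 / ((n : ℝ) - 1 / 2) := by
  have hn' : (2 : ℝ) ≤ n := by exact_mod_cast hn
  have key : ∑ e ∈ range k, 1 / ((n + e : ℕ) : ℝ) ^ 2 ≤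
      1 / ((n : ℝ) - 1 / 2) - 1 / ((n : ℝ) + k - 1 / 2) := by
    induction k with
    | zero => simp
    | succ k ih =>
      rw [sum_range_succ]
      have hk : (0 : ℝ) ≤ k := Nat.cast_nonneg k
      have : 1 / ((n + k : ℕ) : ℝ) ^ 2 ≤
          1 / ((n : ℝ) + k - 1 / 2) - 1 / ((n : ℝ) + k + 1 / 2) := by
        rw [div_sub_div _ _ (by linarith) (by linarith),
          div_le_div_iff₀ (by positivity) (by nlinarith)]
        push_cast
        nlinarith
      push_cast at this ih ⊢
      rw [show (n : ℝ) + (k + 1) - 1 / 2 = n + k + 1 / 2 by ring]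
      linarith
  have : (0 : ℝ) ≤ 1 / ((n : ℝ) + k - 1 / 2) := by
    have hk : (0 : ℝ) ≤ k := Nat.cast_nonneg k
    exact div_nonneg zero_le_one (by linarith)
  linarith

/-- With probability at least `1 - δ`, the estimates are accurate at every check. -/
theorem measure_not_pairAccurate_le (hI : I.Valid)
    (hX : ∀ t, ∀ i < I.m, ∀ a, Measurable (X t i a))
    (hind : iIndepFun (fun q : ℕ × Fin I.m × Fin n => X q.1 (q.2.1 : ℕ) q.2.2) P)
    (hsub : ∀ t, ∀ i < I.m, ∀ a, HasSubgaussianMGF (fun ω => X t i a ω - u a)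
      (Real.toNNReal (I.σ ^ 2 / I.s i)) P) :
    P {ω | ¬ ∀ t, I.IsCheck (I.run (fun t i a => X t i a ω) t) →
      I.PairAccurate u (I.run (fun t i a => X t i a ω) t)} ≤ ENNReal.ofReal I.δ := by
  have hn := hI.two_le_n
  have hn' : (2 : ℝ) ≤ n := by exact_mod_cast hn
  have hδ := hI.δ_mem.1
  have hsubset : {ω | ¬ ∀ t, I.IsCheck (I.run (fun t i a => X t i a ω) t) →
      I.PairAccurate u (I.run (fun t i a => X t i a ω) t)} ⊆
      ⋃ e : ℕ, {ω | ∃ i, (i + 2) ^ 2 ≤ 2 * (n + e) ∧ ¬ I.NoDeviation u (n + e) i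
        (I.run (fun t i a => X t i a ω) (I.checkTime (n + e) i))} := by
    intro ω hω
    simp only [Set.mem_ofPred_eq, not_forall] at hω
    obtain ⟨t, hc, hp⟩ := hω
    obtain ⟨N, ht, hN, hi, hcost, hinfo⟩ := (runInv hI _ t).exists_pulls hI hc
    obtain ⟨e, rfl⟩ := Nat.exists_eq_add_of_le hN
    refine Set.mem_iUnion.mpr ⟨e, (I.run (fun t i a => X t i a ω) t).stage, hi, fun hdev => hp ?_⟩
    rw [checkTime, ← ht] at hdev
    exact hdev.pairAccurate hI hN hc.1 hcost hinfo
  refine (measure_mono hsubset).trans ((measure_iUnion_le _).trans ((ENNReal.tsum_le_tsum fun e =>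
    measure_exists_stage_le hI hX hind hsub (Nat.le_add_right n e)).trans ?_))
  refine ENNReal.tsum_le_of_sum_range_le fun k => ?_
  rw [← ENNReal.ofReal_sum_of_nonneg (fun e _ => by positivity)]
  refine ENNReal.ofReal_le_ofReal ?_
  have e1 : ∑ e ∈ range k, I.δ * (172 / 250 * n / ((n + e : ℕ) : ℝ) ^ 2) =
      I.δ * (172 / 250 * n * ∑ e ∈ range k, 1 / ((n + e : ℕ) : ℝ) ^ 2) := by
    rw [mul_sum, mul_sum]
    refine sum_congr rfl fun e _ => ?_
    ring
  rw [e1]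
  refine mul_le_of_le_one_right hδ.le ?_
  calc 172 / 250 * (n : ℝ) * ∑ e ∈ range k, 1 / ((n + e : ℕ) : ℝ) ^ 2
      ≤ 172 / 250 * n * (1 / (n - 1 / 2)) := by
        have := sum_inv_sq_le hn k
        gcongr
    _ ≤ 1 := by
        rw [mul_one_div, div_le_one (by linarith)]
        linarith

end Probability

end CacoInput

/-! ### Solving the implicit cost bound -/

/-- `y log (c T ^ 4 / δ)` is bounded by `y log (y / δ)`, up to a constant and a term that is small
compared with `T`: for `y` below a power of `T`, of `δ` or below a constant the left-hand side is
small, and otherwise the logarithms are comparable. -/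
theorem mul_log_le {y δ T J : ℝ} (hy : 0 ≤ y) (hδ0 : 0 < δ) (hδ1 : δ < 1) (hT : 1 ≤ T)
    (hJ : 1 ≤ J) :
    -1 ≤ y * Real.log (y * J / δ) ∧
    y * Real.log (4 * T ^ 4 / δ) ≤ 19 * (y * Real.log (y * J / δ)) + 26 + 16 * √T := by
  have hsT : 0 ≤ √T := Real.sqrt_nonneg T
  rcases hy.eq_or_lt with rfl | hy0
  · simp only [zero_mul, mul_zero]
    constructor <;> linarith
  set z := y * Real.log (y / δ) with hz
  have hzJ : z ≤ y * Real.log (y * J / δ) := by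
    refine mul_le_mul_of_nonneg_left (Real.log_le_log (by positivity) ?_) hy
    gcongr
    exact le_mul_of_one_le_right hy hJ
  set ℓ := -Real.log δ with hℓ
  have hℓ0 : 0 ≤ ℓ := by
    have := Real.log_nonpos hδ0.le hδ1.le
    linarith
  have hz2 : z = y * Real.log y + y * ℓ := by
    rw [hz, Real.log_div hy0.ne' hδ0.ne', hℓ]
    ring
  have hyl : -1 ≤ y * Real.log y := by
    have h1 := Real.one_sub_inv_le_log_of_pos hy0
    have h2 := mul_le_mul_of_nonneg_left h1 hy
    rw [mul_sub, mul_inv_cancel₀ hy0.ne'] at h2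
    linarith
  have hyℓ : 0 ≤ y * ℓ := mul_nonneg hy hℓ0
  have hz1 : -1 ≤ z := by linarith
  have hT0 : 0 < T := by linarith
  have a1 : y * Real.log 4 ≤ z + 7 := by
    have hl4 : Real.log 4 ≤ 3 / 2 := by
      rw [show (4 : ℝ) = 2 ^ 2 by norm_num, Real.log_pow]
      have := Real.log_two_lt_d9
      push_cast
      linarith
    rcases le_total y 4 with h | h
    · have : 0 ≤ Real.log 4 := Real.log_nonneg (by norm_num)
      nlinarith
    · have := mul_le_mul_of_nonneg_left (Real.log_le_log (by norm_num) h) hy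
      linarith
  have a2 : y * ℓ ≤ 2 * z + 3 := by
    have hsδ : 0 < √δ := Real.sqrt_pos.mpr hδ0
    rcases le_total y (√δ) with h | h
    · -- `√δ log (1 / δ) ≤ 2`
      have h1 := Real.one_sub_inv_le_log_of_pos hsδ
      rw [Real.log_sqrt hδ0.le] at h1
      have h2 : √δ * (√δ)⁻¹ = 1 := mul_inv_cancel₀ hsδ.ne'
      have h3 : √δ * ℓ ≤ 2 := by
        have := mul_le_mul_of_nonneg_left h1 hsδ.le
        rw [mul_sub, h2] at this
        rw [hℓ]
        linarith
      have h4 := mul_le_mul_of_nonneg_right h hℓ0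
      linarith
    · have h1 := mul_le_mul_of_nonneg_left (Real.log_le_log hsδ h) hy
      rw [Real.log_sqrt hδ0.le] at h1
      rw [hz2]
      have : y * (Real.log δ / 2) = -(y * ℓ) / 2 := by rw [hℓ]; ring
      linarith
  have a3 : y * Real.log T ≤ 4 * (z + 1) + 4 * √T := by
    have hq0 : 0 < √√T := Real.sqrt_pos.mpr (Real.sqrt_pos.mpr hT0)
    have hlq : Real.log T = 4 * Real.log (√√T) := by
      rw [Real.log_sqrt hsT, Real.log_sqrt hT0.le]
      ring
    have hqq : √√T * √√T = √T := Real.mul_self_sqrt hsT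
    rcases le_total y (√√T) with h | h
    · have h1 : Real.log (√√T) ≤ √√T := (Real.log_le_sub_one_of_pos hq0).trans (by linarith)
      have h2 : y * Real.log (√√T) ≤ √√T * √√T := by
        have : 0 ≤ Real.log (√√T) := by
          have := Real.log_nonneg hT
          linarith
        gcongr
      rw [hlq]
      linarith
    · have := mul_le_mul_of_nonneg_left (Real.log_le_log hq0 h) hy
      rw [hlq]
      linarith
  refine ⟨hz1.trans hzJ, ?_⟩
  rw [Real.log_div (by positivity) hδ0.ne', Real.log_mul (by norm_num) (by positivity),
    Real.log_pow]
  push_cast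
  have : y * (Real.log 4 + 4 * Real.log T - Real.log δ) =
      y * Real.log 4 + 4 * (y * Real.log T) + y * ℓ := by rw [hℓ]; ring
  rw [this]
  linarith

/-- Solving the implicit bound on the total cost `T`, in which `T` occurs in the logarithms. -/
theorem cost_le_of_implicit {m : ℕ} {A T δ : ℝ} {y J : ℕ → ℝ} (hδ0 : 0 < δ) (hδ1 : δ < 1)
    (hT : 1 ≤ T) (hm : (m : ℝ) ^ 2 ≤ 2 * A) (hm2 : 2 * (m : ℝ) ≤ A)
    (hy : ∀ l < m, 0 ≤ y l) (hJ : ∀ l < m, 1 ≤ J l)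
    (h : T ≤ A + 128 * ∑ l ∈ range m, y l * Real.log (4 * T ^ 4 / δ)) :
    T ≤ 2 * 10 ^ 7 * (A + ∑ l ∈ range m, y l * Real.log (y l * J l / δ)) := by
  set Y := ∑ l ∈ range m, y l * Real.log (y l * J l / δ) with hY
  have h1 : -(m : ℝ) ≤ Y := by
    have : ∑ _l ∈ range m, (-1 : ℝ) ≤ Y := sum_le_sum fun l hl =>
      (mul_log_le (hy l (mem_range.mp hl)) hδ0 hδ1 hT (hJ l (mem_range.mp hl))).1
    simpa using this
  have h2 : ∑ l ∈ range m, y l * Real.log (4 * T ^ 4 / δ) ≤ 19 * Y + m * (26 + 16 * √T) := by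
    have : ∑ l ∈ range m, y l * Real.log (4 * T ^ 4 / δ) ≤
        ∑ l ∈ range m, (19 * (y l * Real.log (y l * J l / δ)) + (26 + 16 * √T)) :=
      sum_le_sum fun l hl => by
        have := (mul_log_le (hy l (mem_range.mp hl)) hδ0 hδ1 hT (hJ l (mem_range.mp hl))).2
        linarith
    rw [sum_add_distrib, ← mul_sum, sum_const, card_range, nsmul_eq_mul] at this
    exact this
  have h3 : 2048 * (m * √T) ≤ T / 2 + 2048 ^ 2 * A := by
    have e : √T ^ 2 = T := Real.sq_sqrt (by linarith)
    nlinarith [sq_nonneg (√T - 2048 * m)]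
  linarith

/-! ### The theorem -/

namespace CacoInput

variable {n : ℕ} {I : CacoInput n} {u : Fin n → ℝ}

/-- The cost bound for an accurate run, with the total cost eliminated from the logarithms. -/
theorem halted_cost_le (hI : I.Valid) {act : ℕ → Finset (Fin n)} {T : ℝ} (hn : (n : ℝ) ≤ T)
    (hT : T ≤ ∑ l ∈ range I.m, I.stageBound u act T l) :
    T ≤ 2 * 10 ^ 7 * (∑ i ∈ range I.m, I.j i * (I.K i : ℝ) +
      I.σ ^ 2 * ∑ i ∈ range I.m, I.j i / I.s i * I.stageHardness u i (act i) *
        Real.log (I.σ ^ 2 * I.j i ^ 4 / (I.s i * I.δ) * I.stageHardness u i (act i))) := by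
  have hn2 : (2 : ℝ) ≤ n := by exact_mod_cast hI.two_le_n
  have hT1 : 1 ≤ T := by linarith
  have hδ := hI.δ_mem
  have hδ0 := hδ.1
  have hm := hI.m_pos
  have hjK : ∀ l ∈ range I.m, (I.K l : ℝ) ≤ I.j l * I.K l := fun l hl =>
    le_mul_of_one_le_left (Nat.cast_nonneg _) (hI.j_ge l (mem_range.mp hl))
  have hA1 : (I.m : ℝ) ^ 2 ≤ 2 * ∑ l ∈ range I.m, I.j l * (I.K l : ℝ) := by
    have h1 := hI.sq_le_firstPulls (i := I.m - 1) (by omega)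
    rw [Nat.sub_add_cancel hm] at h1
    have h2 : I.m ^ 2 ≤ 2 * I.firstPulls I.m :=
      (Nat.pow_le_pow_left (by omega) 2).trans h1
    have h3 : (I.m : ℝ) ^ 2 ≤ 2 * (I.firstPulls I.m : ℝ) := by exact_mod_cast h2
    refine h3.trans (mul_le_mul_of_nonneg_left ?_ zero_le_two)
    unfold firstPulls
    push_cast
    exact sum_le_sum hjK
  have hA2 : 2 * (I.m : ℝ) ≤ ∑ l ∈ range I.m, I.j l * (I.K l : ℝ) := by
    have : ∑ _l ∈ range I.m, (2 : ℝ) ≤ ∑ l ∈ range I.m, I.j l * (I.K l : ℝ) :=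
      sum_le_sum fun l hl => le_trans
        (by exact_mod_cast hI.two_le_K (mem_range.mp hl)) (hjK l hl)
    rw [sum_const, card_range, nsmul_eq_mul] at this
    linarith
  have hy : ∀ l < I.m, 0 ≤ I.σ ^ 2 * I.j l / I.s l * I.stageHardness u l (act l) := fun l hl => by
    have h1 := hI.s_pos l hl
    have h2 := zero_le_one.trans (hI.j_ge l hl)
    have h3 := stageHardness_nonneg (I := I) (u := u) (i := l) (A := act l)
    positivity
  have hlog : I.logCost T ≤ Real.log (4 * T ^ 4 / I.δ) := by
    refine Real.log_le_log (by positivity) ?_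
    gcongr ?_ / _
    have : (0 : ℝ) ≤ T ^ 3 := by positivity
    nlinarith
  have himp : T ≤ ∑ l ∈ range I.m, I.j l * (I.K l : ℝ) +
      128 * ∑ l ∈ range I.m, I.σ ^ 2 * I.j l / I.s l * I.stageHardness u l (act l) *
        Real.log (4 * T ^ 4 / I.δ) := by
    refine hT.trans ?_
    rw [mul_sum, ← sum_add_distrib]
    refine sum_le_sum fun l hl => ?_
    have := mul_le_mul_of_nonneg_left hlog (hy l (mem_range.mp hl))
    unfold stageBound
    linarith
  refine (cost_le_of_implicit hδ.1 hδ.2 hT1 hA1 hA2 hy (J := fun l => I.j l ^ 3)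
    (fun l hl => one_le_pow₀ (hI.j_ge l hl)) himp).trans (le_of_eq ?_)
  congr 2
  rw [mul_sum]
  refine sum_congr rfl fun l hl => ?_
  have hs := (hI.s_pos l (mem_range.mp hl)).ne'
  have e : I.σ ^ 2 * I.j l / I.s l * I.stageHardness u l (act l) * I.j l ^ 3 / I.δ =
      I.σ ^ 2 * I.j l ^ 4 / (I.s l * I.δ) * I.stageHardness u l (act l) := by
    field_simp
  rw [e]
  ring

end CacoInput

end

theorem theorem1 :
    ∃ C : ℝ, 0 < C ∧
      ∀ (n : ℕ) (I : CacoInput n) (u : Fin n → ℝ)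
        (Ω : Type*) [MeasurableSpace Ω] (P : MeasureTheory.Measure Ω)
        [MeasureTheory.IsProbabilityMeasure P]
        (X : ℕ → ℕ → Fin n → Ω → ℝ),
        I.Valid →
        (∀ t, ∀ i < I.m, ∀ a, Measurable (X t i a)) →
        ProbabilityTheory.iIndepFun
          (fun q : ℕ × Fin I.m × Fin n => X q.1 (q.2.1 : ℕ) q.2.2) P →
        (∀ t, ∀ i < I.m, ∀ a, ∫ ω, X t i a ω ∂P = u a) →
        (∀ t, ∀ i < I.m, ∀ a, ProbabilityTheory.HasSubgaussianMGF
          (fun ω => X t i a ω - u a) (Real.toNNReal (I.σ ^ 2 / I.s i)) P) →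
        ENNReal.ofReal (1 - I.δ) ≤
          P {ω | ∃ t : ℕ, ∃ st : CacoState n,
            st = I.run (fun t' i a => X t' i a ω) t ∧
            st.stage = I.m ∧
            |cohortValue u (st.active I.m) -
              cohortValue u (I.optimal u (I.m - 1) (st.active (I.m - 1)))| < I.ε ∧
            st.cost ≤ C * (∑ i ∈ Finset.range I.m, I.j i * (I.K i : ℝ) +
              I.σ ^ 2 * ∑ i ∈ Finset.range I.m,
                I.j i / I.s i * I.stageHardness u i (st.active i) *
                  Real.log (I.σ ^ 2 * I.j i ^ 4 / (I.s i * I.δ) *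
                    I.stageHardness u i (st.active i)))} := by
  refine ⟨2 * 10 ^ 7, by norm_num, ?_⟩
  intro n I u Ω _ P _ X hI hX hind _ hsub
  have hbad := CacoInput.measure_not_pairAccurate_le (u := u) hI hX hind hsub
  set B : Set Ω := {ω | ¬ ∀ t, I.IsCheck (I.run (fun t i a => X t i a ω) t) →
    I.PairAccurate u (I.run (fun t i a => X t i a ω) t)} with hB
  have hone : 1 ≤ P Bᶜ + P B := by
    rw [← MeasureTheory.measure_univ (μ := P), ← Set.compl_union_self B]
    exact MeasureTheory.measure_union_le _ _
  have hgood : ENNReal.ofReal (1 - I.δ) ≤ P Bᶜ := by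
    rw [ENNReal.ofReal_sub _ hI.δ_mem.1.le, ENNReal.ofReal_one, tsub_le_iff_right]
    exact hone.trans (add_le_add le_rfl hbad)
  refine hgood.trans (MeasureTheory.measure_mono fun ω hω => ?_)
  have hacc : ∀ t, I.IsCheck (I.run (fun t i a => X t i a ω) t) →
      I.PairAccurate u (I.run (fun t i a => X t i a ω) t) := not_not.mp hω
  obtain ⟨t, ht⟩ := CacoInput.exists_halted hI _ hacc
  obtain ⟨h1, h2, h3⟩ := CacoInput.halted_spec hI _ hacc ht
  exact ⟨t, _, rfl, ht, h1, CacoInput.halted_cost_le hI h2 h3⟩
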